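/- Let $k$ be a field of characteristic $0$, let $X/k$ be a regular variety, i.e. an irreducible scheme of finite type over $k$ all of whose local rings are regular, and let $M$ be a locally free $\mathcal O_X$-module of finite rank. For $n\ge 0$ let $\mathcal P^n(M)=\mathcal P^n_{X/k}\otimes_{\mathcal O_X}M$ be the sheaf of principal parts of order $n$, where $\mathcal P^n_{X/k}=\mathcal O_{X\times_k X}/I_\Delta^{n+1}$, the tensor product is formed with the right $\mathcal O_X$-structure of $\mathcal P^n_{X/k}$, and $\mathcal P^n(M)$ is an $\mathcal O_X$-module through the left one. Let $\mathcal D^n(M)=\mathcal Hom_{\mathcal O_X}(\mathcal P^n(M),M)$ be the sheaf of differential operators of order at most $n$ on $M$. Let $x$ be a point of $X$ with residue field $k_x$, and let $V$ be a finite-dimensional $k$-subspace either of the stalk $M_x$ or of $\Gamma(X,M)$. Consider the map of fibres of the Taylor map $$d^n_V(x):\ k_x\otimes_k V\to k_x\otimes_{\mathcal O_{X,x}}\mathcal P^n(M)_x,\qquad c\otimes v\mapsto c\otimes(1\otimes v),$$ and the evaluation map $$W^n_x:\ \mathcal D^n(M)_x\to \mathrm{Hom}_k(V,M_x),\qquad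 \varphi\mapsto\bigl(v\mapsto \varphi(1\otimes v)\bigr),$$ where $v\in V$ is replaced by its germ at $x$ if $V\subset\Gamma(X,M)$. Suppose that $V$ is separated at $x$, i.e. that there is an integer $N$ such that $d^n_V(x)$ is injective for all $n\ge N$, and let $n_{inj}(x)$ be the smallest $n\ge 0$ such that $d^n_V(x)$ is injective. Then $W^n_x$ is surjective for some $n$, and $$n_{inj}(x)=\min\{n\ge 0 \mid W^n_x \text{ is surjective}\}.$$ -/

import Mathlib

open CategoryTheory AlgebraicGeometry TensorProduct Opposite

universe u

noncomputable section

/-! ### Principal parts of an algebra and of a module -/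

/-- The algebra of principal parts of order `n` of a `k`-algebra `R`: the quotient
`(R ⊗[k] R) ⧸ I ^ (n + 1)`, where `I` is the kernel of the multiplication `R ⊗[k] R → R`. -/
def PrincipalParts (k R : Type*) [CommRing k] [CommRing R] [Algebra k R] (n : ℕ) : Type _ :=
  (R ⊗[k] R) ⧸ (KaehlerDifferential.ideal k R) ^ (n + 1)

namespace PrincipalParts

variable (k : Type*) [CommRing k] (R : Type*) [CommRing R] [Algebra k R] (n : ℕ)

instance : CommRing (PrincipalParts k R n) :=
  inferInstanceAs (CommRing ((R ⊗[k] R) ⧸ (KaehlerDifferential.ideal k R) ^ (n + 1)))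

/-- The quotient map `R ⊗[k] R → (R ⊗[k] R) ⧸ I ^ (n + 1)`. -/
def mk : R ⊗[k] R →+* PrincipalParts k R n :=
  Ideal.Quotient.mk ((KaehlerDifferential.ideal k R) ^ (n + 1))

lemma mk_surjective : Function.Surjective (mk k R n) := Ideal.Quotient.mk_surjective

/-- The left structure map `r ↦ r ⊗ 1`. -/
def left : R →+* PrincipalParts k R n :=
  (mk k R n).comp (Algebra.TensorProduct.includeLeft : R →ₐ[k] R ⊗[k] R).toRingHom

/-- The right structure map `r ↦ 1 ⊗ r`. -/
def right : R →+* PrincipalParts k R n :=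
  (mk k R n).comp (Algebra.TensorProduct.includeRight : R →ₐ[k] R ⊗[k] R).toRingHom

/-- The registered `R`-algebra structure is the right one; it is the one that is used to form
the tensor product of the principal parts with a module. -/
instance : Algebra R (PrincipalParts k R n) := (right k R n).toAlgebra

lemma right_algebraMap (c : k) :
    right k R n (algebraMap k R c) = left k R n (algebraMap k R c) := by
  simp [left, right]

variable {k R}
variable {R' : Type*} [CommRing R'] [Algebra k R'] (σ : R →ₐ[k] R')

lemma ideal_pow_le : KaehlerDifferential.ideal k R ^ (n + 1) ≤
    (KaehlerDifferential.ideal k R' ^ (n + 1)).comap (Algebra.TensorProduct.map σ σ) := by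
  refine (Ideal.pow_right_mono ?_ _).trans (Ideal.le_comap_pow _ _)
  rw [← KaehlerDifferential.span_range_eq_ideal k R, Ideal.span_le]
  rintro _ ⟨a, rfl⟩
  simp [RingHom.mem_ker]

/-- Functoriality of the principal parts: `a ⊗ b ↦ σ a ⊗ σ b`. -/
def map : PrincipalParts k R n →+* PrincipalParts k R' n :=
  Ideal.quotientMap _ (Algebra.TensorProduct.map σ σ).toRingHom (ideal_pow_le n σ)

lemma map_mk (a : R ⊗[k] R) :
    map n σ (mk k R n a) = mk k R' n (Algebra.TensorProduct.map σ σ a) :=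
  rfl

lemma map_left (a : R) : map n σ (left k R n a) = left k R' n (σ a) := by
  simp [left, map_mk]

lemma map_right (a : R) : map n σ (right k R n a) = right k R' n (σ a) := by
  simp [right, map_mk]

lemma map_id (a : PrincipalParts k R n) : map n (AlgHom.id k R) a = a := by
  obtain ⟨a, rfl⟩ := mk_surjective k R n a
  simp [map_mk]

lemma map_comp {R'' : Type*} [CommRing R''] [Algebra k R''] (τ : R' →ₐ[k] R'')
    (a : PrincipalParts k R n) : map n (τ.comp σ) a = map n τ (map n σ a) := by
  obtain ⟨a, rfl⟩ := mk_surjective k R n a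
  simp [map_mk, Algebra.TensorProduct.map_comp]

end PrincipalParts

/-- The principal parts of order `n` of an `R`-module `M`: the tensor product over `R` of the
principal parts of `R`, with their right `R`-structure, and `M`. -/
def PrincipalPartsModule (k R : Type*) [CommRing k] [CommRing R] [Algebra k R] (n : ℕ)
    (M : Type*) [AddCommGroup M] [Module R M] : Type _ :=
  PrincipalParts k R n ⊗[R] M

namespace PrincipalPartsModule

variable (k : Type*) [CommRing k] {R : Type*} [CommRing R] [Algebra k R] (n : ℕ)
  {M : Type*} [AddCommGroup M] [Module R M]

instance : AddCommGroup (PrincipalPartsModule k R n M) :=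
  inferInstanceAs (AddCommGroup (PrincipalParts k R n ⊗[R] M))

instance : Module (PrincipalParts k R n) (PrincipalPartsModule k R n M) :=
  inferInstanceAs (Module (PrincipalParts k R n) (PrincipalParts k R n ⊗[R] M))

/-- The `R`-module structure of the principal parts of `M` is the left one. -/
instance : Module R (PrincipalPartsModule k R n M) :=
  Module.compHom _ (PrincipalParts.left k R n)

/-- Pure tensors. -/
def tmul (a : PrincipalParts k R n) (m : M) : PrincipalPartsModule k R n M := a ⊗ₜ[R] m

lemma smul_tmul (r : R) (a : PrincipalParts k R n) (m : M) :
    r • tmul k n a m = tmul k n (PrincipalParts.left k R n r * a) m := rfl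

lemma tmul_smul (r : R) (a : PrincipalParts k R n) (m : M) :
    tmul k n a (r • m) = tmul k n (PrincipalParts.right k R n r * a) m :=
  (TensorProduct.smul_tmul (R := R) (R' := R) (M := PrincipalParts k R n) (N := M) r a m).symm

@[elab_as_elim]
lemma induction_on {p : PrincipalPartsModule k R n M → Prop} (z : PrincipalPartsModule k R n M)
    (zero : p 0) (tmul : ∀ a m, p (tmul k n a m)) (add : ∀ x y, p x → p y → p (x + y)) : p z :=
  TensorProduct.induction_on z zero tmul add

variable (R M) in
/-- The universal differential operator of order `n`: `m ↦ 1 ⊗ m`. -/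
def taylor : M →+ PrincipalPartsModule k R n M where
  toFun m := tmul k n 1 m
  map_zero' := TensorProduct.tmul_zero _ _
  map_add' := TensorProduct.tmul_add _

lemma taylor_algebraMap_smul (c : k) (m : M) :
    taylor k R n M (algebraMap k R c • m) = algebraMap k R c • taylor k R n M m := by
  change tmul k n (1 : PrincipalParts k R n) (algebraMap k R c • m) =
    algebraMap k R c • tmul k n (1 : PrincipalParts k R n) m
  rw [tmul_smul, PrincipalParts.right_algebraMap, smul_tmul]

variable {k}
variable {R' : Type*} [CommRing R'] [Algebra k R'] (σ : R →ₐ[k] R')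
  {M' : Type*} [AddCommGroup M'] [Module R' M'] (g : M →ₛₗ[(σ : R →+* R')] M')

/-- `PrincipalParts.map`, semilinear for the right structures. -/
def mapAux : PrincipalParts k R n →ₛₗ[(σ : R →+* R')] PrincipalParts k R' n where
  toFun := PrincipalParts.map n σ
  map_add' := map_add _
  map_smul' r a := by
    rw [Algebra.smul_def, map_mul, Algebra.smul_def]
    congr 1
    exact PrincipalParts.map_right n σ r

/-- Functoriality of the principal parts of modules: `a ⊗ m ↦ σ a ⊗ g m`. -/
def map : PrincipalPartsModule k R n M →+ PrincipalPartsModule k R' n M' :=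
  (TensorProduct.map (mapAux n σ) g).toAddMonoidHom

lemma map_tmul (a : PrincipalParts k R n) (m : M) :
    map n σ g (tmul k n a m) = tmul k n (PrincipalParts.map n σ a) (g m) := rfl

lemma map_smul (r : R) (z : PrincipalPartsModule k R n M) :
    map n σ g (r • z) = σ r • map n σ g z := by
  induction z using induction_on with
  | zero => simp
  | tmul a m => simp only [smul_tmul, map_tmul, map_mul, PrincipalParts.map_left]
  | add x y hx hy => simp only [smul_add, map_add, hx, hy]

end PrincipalPartsModule

namespace AlgebraicGeometry.Scheme

/-! ### Scalars and stalks -/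

section Scalars

variable (k : Type u) [CommRing k] (X : Scheme.{u}) [X.Over (Spec (.of k))]

/-- The ring homomorphism `k → Γ(X, U)` given by the structure morphism `X ⟶ Spec k`. -/
def scalars (U : X.Opens) : k →+* Γ(X, U) :=
  (X.presheaf.map (homOfLE (le_top : U ≤ ⊤)).op).hom.comp
    ((X ↘ Spec (.of k)).appTop.hom.comp (Scheme.ΓSpecIso (.of k)).inv.hom)

instance (U : X.Opens) : Algebra k Γ(X, U) := (scalars k X U).toAlgebra

instance (x : X) : Algebra k (X.presheaf.stalk x) :=
  ((X.presheaf.germ ⊤ x (TopologicalSpace.Opens.mem_top x)).hom.comp (scalars k X ⊤)).toAlgebra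

variable {X}

lemma germ_algebraMap (x : X) (U : X.Opens) (hx : x ∈ U) (c : k) :
    X.presheaf.germ U x hx (algebraMap k Γ(X, U) c) = algebraMap k (X.presheaf.stalk x) c := by
  change X.presheaf.germ U x hx ((X.presheaf.map (homOfLE (le_top : U ≤ ⊤)).op).hom _) =
    X.presheaf.germ ⊤ x (TopologicalSpace.Opens.mem_top x)
      ((X.presheaf.map (homOfLE (le_top : (⊤ : X.Opens) ≤ ⊤)).op).hom _)
  exact (TopCat.Presheaf.germ_res_apply _ _ _ _ _).trans
    (TopCat.Presheaf.germ_res_apply _ _ _ _ _).symm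

/-- The restriction maps of the structure sheaf as homomorphisms of `k`-algebras. -/
def resAlgHom {U V : X.Opens} (i : V ⟶ U) : Γ(X, U) →ₐ[k] Γ(X, V) where
  __ := (X.presheaf.map i.op).hom
  commutes' c := by
    change (X.presheaf.map i.op).hom ((X.presheaf.map (homOfLE (le_top : U ≤ ⊤)).op).hom _) =
      (X.presheaf.map (homOfLE (le_top : V ≤ ⊤)).op).hom _
    rw [← CommRingCat.comp_apply, ← Functor.map_comp]
    rfl

end Scalars

namespace Modules

variable {X : Scheme.{u}}

instance (M : X.Modules) (x : X) : Module (X.presheaf.stalk x) (M.presheaf.stalk x) :=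
  let N : _root_.PresheafOfModules.{u} (X.presheaf ⋙ forget₂ CommRingCat RingCat) := M.val
  inferInstanceAs (Module (X.presheaf.stalk x)
    (TopCat.Presheaf.stalk (C := AddCommGrpCat.{u}) (X := X.carrier) N.presheaf x))

lemma germ_smul (M : X.Modules) (x : X) (U : X.Opens) (hx : x ∈ U) (r : Γ(X, U)) (m : Γ(M, U)) :
    M.presheaf.germ U x hx (r • m) = X.presheaf.germ U x hx r • M.presheaf.germ U x hx m :=
  PresheafOfModules.germ_smul (R := X.presheaf)
    (M.val : _root_.PresheafOfModules.{u} (X.presheaf ⋙ forget₂ CommRingCat RingCat)) x U hx r m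

/-- `M` is locally free of finite rank: every point has an open neighbourhood `U` on which `M` is
isomorphic to a finite direct sum of copies of the structure sheaf. -/
def IsLocallyFreeOfFiniteRank (M : X.Modules) : Prop :=
  ∀ x : X, ∃ U : X.Opens, x ∈ U ∧ ∃ r : ℕ,
    Nonempty (M.restrict U.ι ≅
      SheafOfModules.free (R := (U : Scheme.{u}).ringCatSheaf) (ULift.{u} (Fin r)))

section Hom

/-! ### The sheaf of homomorphisms and its stalks -/

/-- The group of `𝒪_U`-linear homomorphisms `P|_U ⟶ M|_U`: the families of linear maps
`Γ(P, W) → Γ(M, W)`, for `W ≤ U` open, that commute with restriction. -/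
def homOn (P M : X.Modules) (U : X.Opens) :
    AddSubgroup (∀ W : {W : X.Opens // W ≤ U}, Γ(P, W.1) →ₗ[Γ(X, W.1)] Γ(M, W.1)) where
  carrier := {φ | ∀ (W W' : {W : X.Opens // W ≤ U}) (i : W'.1 ⟶ W.1) (s : Γ(P, W.1)),
    φ W' (P.presheaf.map i.op s) = M.presheaf.map i.op (φ W s)}
  zero_mem' W W' i s := by simp
  add_mem' {φ ψ} hφ hψ W W' i s := by simp [hφ W W' i s, hψ W W' i s]
  neg_mem' {φ} hφ W W' i s := by simp [hφ W W' i s]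

/-- Restriction of homomorphisms to a smaller open subset. -/
def homOnRes (P M : X.Modules) {U V : X.Opens} (h : V ≤ U) : homOn P M U →+ homOn P M V where
  toFun φ := ⟨fun W => φ.1 ⟨W.1, W.2.trans h⟩, fun W W' i s =>
    φ.2 ⟨W.1, W.2.trans h⟩ ⟨W'.1, W'.2.trans h⟩ i s⟩
  map_zero' := rfl
  map_add' _ _ := rfl

/-- The sheaf of homomorphisms from `P` to `M`, as a presheaf of abelian groups. -/
def sheafHom (P M : X.Modules) : TopCat.Presheaf AddCommGrpCat.{u} X where
  obj U := AddCommGrpCat.of (homOn P M U.unop)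
  map i := AddCommGrpCat.ofHom (homOnRes P M i.unop.le)
  map_id _ := rfl
  map_comp _ _ := rfl

variable {P M : X.Modules} (x : X)

lemma homOn_germ_eq {U : X.Opens} (φ : homOn P M U) {W W' : X.Opens}
    (hW : W ≤ U) (hW' : W' ≤ U) (i : W' ⟶ W) (hxW' : x ∈ W') (s : Γ(P, W)) :
    M.presheaf.germ W' x hxW' (φ.1 ⟨W', hW'⟩ (P.presheaf.map i.op s)) =
      M.presheaf.germ W x (i.le hxW') (φ.1 ⟨W, hW⟩ s) := by
  rw [φ.2 ⟨W, hW⟩ ⟨W', hW'⟩ i s]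
  exact TopCat.Presheaf.germ_res_apply _ _ _ _ _

/-- The cocone that defines the map of stalks at `x` of a homomorphism over an open
neighbourhood `U` of `x`. -/
def homStalkCocone {U : X.Opens} (hx : x ∈ U) (φ : homOn P M U) :
    Limits.Cocone ((TopologicalSpace.OpenNhds.inclusion x).op ⋙ P.presheaf) where
  pt := M.presheaf.stalk x
  ι :=
    { app W := AddCommGrpCat.ofHom
        ((M.presheaf.germ (W.unop.1 ⊓ U) x ⟨W.unop.2, hx⟩).hom.comp
          ((φ.1 ⟨W.unop.1 ⊓ U, inf_le_right⟩).toAddMonoidHom.comp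
            (P.presheaf.map (homOfLE (inf_le_left : W.unop.1 ⊓ U ≤ W.unop.1)).op).hom))
      naturality W W' i := by
        ext s
        refine Eq.trans (congrArg (M.presheaf.germ (W'.unop.1 ⊓ U) x ⟨W'.unop.2, hx⟩)
          (congrArg (φ.1 ⟨W'.unop.1 ⊓ U, inf_le_right⟩) ?_)) (homOn_germ_eq x φ inf_le_right
            inf_le_right (homOfLE (inf_le_inf_right U i.unop.le)) ⟨W'.unop.2, hx⟩
            (P.presheaf.map (homOfLE (inf_le_left : W.unop.1 ⊓ U ≤ W.unop.1)).op s))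
        exact (ConcreteCategory.congr_hom (P.presheaf.map_comp
            ((TopologicalSpace.OpenNhds.inclusion x).op.map i)
            (homOfLE (inf_le_left : W'.unop.1 ⊓ U ≤ W'.unop.1)).op) s).symm.trans
          (ConcreteCategory.congr_hom (P.presheaf.map_comp
            (homOfLE (inf_le_left : W.unop.1 ⊓ U ≤ W.unop.1)).op
            (homOfLE (inf_le_inf_right U i.unop.le : W'.unop.1 ⊓ U ≤ W.unop.1 ⊓ U)).op) s) }

/-- The map of stalks at `x` of a homomorphism over an open neighbourhood `U` of `x`, as a
homomorphism of groups. -/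
def homStalkAux {U : X.Opens} (hx : x ∈ U) (φ : homOn P M U) :
    P.presheaf.stalk x ⟶ M.presheaf.stalk x :=
  Limits.colimit.desc _ (homStalkCocone x hx φ)

lemma homStalkAux_germ {U : X.Opens} (hx : x ∈ U) (φ : homOn P M U) {W : X.Opens} (hW : W ≤ U)
    (hxW : x ∈ W) (s : Γ(P, W)) :
    homStalkAux x hx φ (P.presheaf.germ W x hxW s) = M.presheaf.germ W x hxW (φ.1 ⟨W, hW⟩ s) := by
  exact (ConcreteCategory.congr_hom (Limits.colimit.ι_desc (homStalkCocone x hx φ)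
      (op (⟨W, hxW⟩ : TopologicalSpace.OpenNhds x))) s).trans
    (homOn_germ_eq x φ hW inf_le_right (homOfLE inf_le_left) ⟨hxW, hx⟩ s)

/-- The map of stalks at `x` of a homomorphism over an open neighbourhood `U` of `x`. -/
def homStalk {U : X.Opens} (hx : x ∈ U) (φ : homOn P M U) :
    P.presheaf.stalk x →ₗ[X.presheaf.stalk x] M.presheaf.stalk x where
  __ := (homStalkAux x hx φ).hom
  map_smul' r s := by
    obtain ⟨W, hW, hxW, r, rfl⟩ := X.presheaf.exists_le_germ_eq r hx
    obtain ⟨W', hW', hxW', s, rfl⟩ := P.presheaf.exists_le_germ_eq s hxW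
    have hr : X.presheaf.germ W x hxW r =
        X.presheaf.germ W' x hxW' (X.presheaf.map (homOfLE hW').op r) :=
      (TopCat.Presheaf.germ_res_apply _ _ _ _ _).symm
    have h (s : Γ(P, W')) := homStalkAux_germ x hx φ (hW'.trans hW) hxW' s
    change homStalkAux x hx φ (_ • _) = _ • homStalkAux x hx φ _
    rw [hr, ← germ_smul, h, h, _root_.map_smul, germ_smul]
    rfl

lemma homStalk_germ {U : X.Opens} (hx : x ∈ U) (φ : homOn P M U) {W : X.Opens} (hW : W ≤ U)
    (hxW : x ∈ W) (s : Γ(P, W)) :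
    homStalk x hx φ (P.presheaf.germ W x hxW s) = M.presheaf.germ W x hxW (φ.1 ⟨W, hW⟩ s) :=
  homStalkAux_germ x hx φ hW hxW s

lemma homStalk_zero {U : X.Opens} (hx : x ∈ U) : homStalk x hx (0 : homOn P M U) = 0 := by
  ext s
  obtain ⟨W, hW, hxW, s, rfl⟩ := P.presheaf.exists_le_germ_eq s hx
  rw [homStalk_germ x hx _ hW hxW]
  exact map_zero _

lemma homStalk_add {U : X.Opens} (hx : x ∈ U) (φ ψ : homOn P M U) :
    homStalk x hx (φ + ψ) = homStalk x hx φ + homStalk x hx ψ := by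
  ext s
  obtain ⟨W, hW, hxW, s, rfl⟩ := P.presheaf.exists_le_germ_eq s hx
  rw [LinearMap.add_apply, homStalk_germ x hx _ hW hxW, homStalk_germ x hx _ hW hxW,
    homStalk_germ x hx _ hW hxW]
  exact map_add _ _ _

lemma homStalk_res {U U' : X.Opens} (hx : x ∈ U') (h : U' ≤ U) (φ : homOn P M U) :
    homStalk x hx (homOnRes P M h φ) = homStalk x (h hx) φ := by
  ext s
  obtain ⟨W, hW, hxW, s, rfl⟩ := P.presheaf.exists_le_germ_eq s hx
  rw [homStalk_germ x hx _ hW hxW, homStalk_germ x (h hx) _ (hW.trans h) hxW]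
  rfl

variable (P M) in
/-- The cocone that defines `sheafHomStalk`. -/
def sheafHomCocone :
    Limits.Cocone ((TopologicalSpace.OpenNhds.inclusion x).op ⋙ sheafHom P M) where
  pt := AddCommGrpCat.of (P.presheaf.stalk x →ₗ[X.presheaf.stalk x] M.presheaf.stalk x)
  ι :=
    { app U := AddCommGrpCat.ofHom
        { toFun φ := homStalk x U.unop.2 φ
          map_zero' := homStalk_zero x U.unop.2
          map_add' φ ψ := homStalk_add x U.unop.2 φ ψ }
      naturality U V i := by
        ext1
        apply AddMonoidHom.ext
        intro φ
        exact homStalk_res x V.unop.2 i.unop.le φ }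

variable (P M) in
/-- The canonical map from the stalk at `x` of the sheaf of homomorphisms to the homomorphisms
of the stalks at `x`. -/
def sheafHomStalk :
    (sheafHom P M).stalk x →+ (P.presheaf.stalk x →ₗ[X.presheaf.stalk x] M.presheaf.stalk x) :=
  AddCommGrpCat.Hom.hom (Limits.colimit.desc _ (sheafHomCocone P M x))

lemma sheafHomStalk_germ {U : X.Opens} (hx : x ∈ U) (φ : homOn P M U) :
    sheafHomStalk P M x ((sheafHom P M).germ U x hx φ) = homStalk x hx φ :=
  ConcreteCategory.congr_hom (Limits.colimit.ι_desc (sheafHomCocone P M x)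
    (op (⟨U, hx⟩ : TopologicalSpace.OpenNhds x))) φ

end Hom

section PrincipalParts

/-! ### The sheaf of principal parts, the Taylor map and differential operators -/

variable (k : Type u) [CommRing k] [X.Over (Spec (.of k))] (M : X.Modules) (n : ℕ)

/-- The sections of `M` over `U` as a `k`-module. -/
instance (U : X.Opens) : Module k Γ(M, U) := Module.compHom _ (algebraMap k Γ(X, U))

/-- The stalk of `M` at `x` as a `k`-module. -/
instance (x : X) : Module k (M.presheaf.stalk x) :=
  Module.compHom _ (algebraMap k (X.presheaf.stalk x))

instance (x : X) : IsScalarTower k (X.presheaf.stalk x) (M.presheaf.stalk x) :=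
  ⟨fun a b c => by rw [Algebra.smul_def, mul_smul]; rfl⟩

/-- Taking germs at `x`, as a `k`-linear map. -/
def germLinear (U : X.Opens) (x : X) (hx : x ∈ U) : Γ(M, U) →ₗ[k] M.presheaf.stalk x where
  __ := (M.presheaf.germ U x hx).hom
  map_smul' c m := by
    change M.presheaf.germ U x hx (algebraMap k Γ(X, U) c • m) =
      algebraMap k (X.presheaf.stalk x) c • M.presheaf.germ U x hx m
    rw [germ_smul, germ_algebraMap]

/-- The restriction maps of `M`, as semilinear maps. -/
def res {U V : X.Opens} (i : V ⟶ U) :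
    Γ(M, U) →ₛₗ[(resAlgHom k i : Γ(X, U) →+* Γ(X, V))] Γ(M, V) where
  __ := (M.presheaf.map i.op).hom
  map_smul' r m := M.map_smul i r m

/-- The module of principal parts of `Γ(M, U)` over `Γ(X, U)`. -/
abbrev principalPartsObj (U : X.Opens) : Type u :=
  PrincipalPartsModule k Γ(X, U) n Γ(M, U)

/-- The restriction maps of the presheaf of principal parts. -/
def principalPartsRes {U V : X.Opens} (i : V ⟶ U) :
    principalPartsObj k M n U →ₛₗ[(X.presheaf.map i.op).hom] principalPartsObj k M n V where
  toFun := PrincipalPartsModule.map n (resAlgHom k i) (M.res k i)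
  map_add' := map_add _
  map_smul' := PrincipalPartsModule.map_smul n (resAlgHom k i) (M.res k i)

lemma principalPartsRes_id (U : X.Opens) (z : principalPartsObj k M n U) :
    principalPartsRes k M n (𝟙 U) z = z := by
  have h1 : resAlgHom k (𝟙 U) = AlgHom.id k _ := by
    ext a; simp [resAlgHom]
  have h2 : ∀ m, M.res k (𝟙 U) m = m := by
    intro m; simp [res]
  change PrincipalPartsModule.map n (resAlgHom k (𝟙 U)) (M.res k (𝟙 U)) z = z
  induction z using PrincipalPartsModule.induction_on with
  | zero => simp
  | tmul a m => rw [PrincipalPartsModule.map_tmul, h2, h1, PrincipalParts.map_id]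
  | add x y hx hy => rw [map_add, hx, hy]

lemma principalPartsRes_comp {U V W : X.Opens} (i : V ⟶ U) (j : W ⟶ V)
    (z : principalPartsObj k M n U) :
    principalPartsRes k M n (j ≫ i) z =
      principalPartsRes k M n j (principalPartsRes k M n i z) := by
  have h1 : resAlgHom k (j ≫ i) = (resAlgHom k j).comp (resAlgHom k i) := by
    ext a; simp [resAlgHom]
  have h2 : ∀ m, M.res k (j ≫ i) m = M.res k j (M.res k i m) := by
    intro m; simp [res]
  change PrincipalPartsModule.map n (resAlgHom k (j ≫ i)) (M.res k (j ≫ i)) z =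
    PrincipalPartsModule.map n (resAlgHom k j) (M.res k j)
    (PrincipalPartsModule.map n (resAlgHom k i) (M.res k i) z)
  induction z using PrincipalPartsModule.induction_on with
  | zero => simp
  | tmul a m => simp only [PrincipalPartsModule.map_tmul, h1, h2, PrincipalParts.map_comp]
  | add x y hx hy => simp only [map_add, hx, hy]

/-- `principalPartsObj` as an object of Mathlib's category of modules. -/
def principalPartsModuleCat (U : X.Opensᵒᵖ) : ModuleCat.{u} (X.ringCatSheaf.obj.obj U) :=
  ModuleCat.of Γ(X, U.unop) (principalPartsObj k M n U.unop)

/-- `principalPartsRes` as a morphism of Mathlib's category of modules. -/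
def principalPartsHom {U V : X.Opensᵒᵖ} (i : U ⟶ V) :
    principalPartsModuleCat k M n U ⟶
      (ModuleCat.restrictScalars (X.ringCatSheaf.obj.map i).hom).obj
        (principalPartsModuleCat k M n V) :=
  ModuleCat.semilinearMapAddEquiv (X.ringCatSheaf.obj.map i).hom
    (principalPartsModuleCat k M n U) (principalPartsModuleCat k M n V)
    { toFun := principalPartsRes k M n i.unop
      map_add' := (principalPartsRes k M n i.unop).map_add
      map_smul' := (principalPartsRes k M n i.unop).map_smulₛₗ }

lemma principalPartsHom_id (U : X.Opensᵒᵖ) : principalPartsHom k M n (𝟙 U) =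
    (ModuleCat.restrictScalarsId' (X.ringCatSheaf.obj.map (𝟙 U)).hom
      (congrArg RingCat.Hom.hom (X.ringCatSheaf.obj.map_id U))).inv.app _ := by
  apply ModuleCat.hom_ext
  apply LinearMap.ext
  intro z
  exact principalPartsRes_id k M n U.unop z

lemma principalPartsHom_comp {U V W : X.Opensᵒᵖ} (i : U ⟶ V) (j : V ⟶ W) :
    principalPartsHom k M n (i ≫ j) =
    principalPartsHom k M n i ≫ (ModuleCat.restrictScalars _).map (principalPartsHom k M n j) ≫
      (ModuleCat.restrictScalarsComp' (X.ringCatSheaf.obj.map i).hom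
        (X.ringCatSheaf.obj.map j).hom (X.ringCatSheaf.obj.map (i ≫ j)).hom
        (congrArg RingCat.Hom.hom <| X.ringCatSheaf.obj.map_comp i j)).inv.app _ := by
  apply ModuleCat.hom_ext
  apply LinearMap.ext
  intro z
  exact principalPartsRes_comp k M n i.unop j.unop z

/-- The presheaf of `𝒪_X`-modules that sends `U` to the principal parts of order `n` of the
`Γ(X, U)`-module `Γ(M, U)` relative to `k`. -/
def principalPartsPresheaf : X.PresheafOfModules where
  obj U := principalPartsModuleCat k M n U
  map i := principalPartsHom k M n i
  map_id U := principalPartsHom_id k M n U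
  map_comp i j := principalPartsHom_comp k M n i j

/-- The sheaf of principal parts of order `n` of `M` relative to `k`, with its left
`𝒪_X`-module structure: the sheaf associated with `principalPartsPresheaf`. -/
def principalParts : X.Modules :=
  (PresheafOfModules.sheafification (𝟙 X.ringCatSheaf.obj)).obj (principalPartsPresheaf k M n)

/-- The canonical map from the presheaf of principal parts to its associated sheaf. -/
def toPrincipalParts (U : X.Opens) :
    principalPartsObj k M n U →ₗ[Γ(X, U)] Γ(principalParts k M n, U) :=
  (((PresheafOfModules.sheafificationAdjunction (𝟙 X.ringCatSheaf.obj)).unit.app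
    (principalPartsPresheaf k M n)).app (op U)).hom

lemma toPrincipalParts_res {U V : X.Opens} (i : V ⟶ U) (z : principalPartsObj k M n U) :
    toPrincipalParts k M n V (principalPartsRes k M n i z) =
      (principalParts k M n).presheaf.map i.op (toPrincipalParts k M n U z) :=
  PresheafOfModules.naturality_apply
    ((PresheafOfModules.sheafificationAdjunction (𝟙 X.ringCatSheaf.obj)).unit.app
      (principalPartsPresheaf k M n)) i.op z

lemma principalPartsRes_taylor {U V : X.Opens} (i : V ⟶ U) (m : Γ(M, U)) :
    principalPartsRes k M n i (PrincipalPartsModule.taylor k Γ(X, U) n Γ(M, U) m) =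
      PrincipalPartsModule.taylor k Γ(X, V) n Γ(M, V) (M.presheaf.map i.op m) :=
  congrArg (fun a => PrincipalPartsModule.tmul k n a (M.res k i m))
    (map_one (PrincipalParts.map n (resAlgHom k i)))

/-- The homomorphism of sheaves of abelian groups from `M` to its principal parts that sends a
section `m` to `1 ⊗ m`. -/
def taylor : M.presheaf ⟶ (principalParts k M n).presheaf where
  app U := AddCommGrpCat.ofHom ((toPrincipalParts k M n U.unop).toAddMonoidHom.comp
    (PrincipalPartsModule.taylor k Γ(X, U.unop) n Γ(M, U.unop)))
  naturality U V i := by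
    ext m
    exact (congrArg (toPrincipalParts k M n V.unop)
      (principalPartsRes_taylor k M n i.unop m)).symm.trans
      (toPrincipalParts_res k M n i.unop _)

variable (x : X)

/-- The map of stalks of `taylor`. -/
def taylorStalk : M.presheaf.stalk x →ₗ[k] (principalParts k M n).presheaf.stalk x where
  __ := ((TopCat.Presheaf.stalkFunctor _ x).map (taylor k M n)).hom
  map_smul' c m := by
    obtain ⟨U, hx, m, rfl⟩ := M.presheaf.exists_germ_eq m
    have h (m : Γ(M, U)) : (TopCat.Presheaf.stalkFunctor _ x).map (taylor k M n)
        (M.presheaf.germ U x hx m) = (principalParts k M n).presheaf.germ U x hx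
          (toPrincipalParts k M n U (PrincipalPartsModule.taylor k Γ(X, U) n Γ(M, U) m)) :=
      TopCat.Presheaf.stalkFunctor_map_germ_apply U x hx (taylor k M n) m
    refine (congrArg ((TopCat.Presheaf.stalkFunctor _ x).map (taylor k M n))
      ((germLinear k M U x hx).map_smul c m).symm).trans ((h _).trans ?_)
    refine Eq.trans ?_ (congrArg (fun z : (principalParts k M n).presheaf.stalk x => c • z)
      (h m).symm)
    refine Eq.trans ?_ ((germLinear k (principalParts k M n) U x hx).map_smul c _)
    refine congrArg ((principalParts k M n).presheaf.germ U x hx) ?_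
    exact (congrArg (toPrincipalParts k M n U)
      (PrincipalPartsModule.taylor_algebraMap_smul k n c m)).trans
        ((toPrincipalParts k M n U).map_smul _ _)

lemma taylorStalk_germ (U : X.Opens) (hx : x ∈ U) (m : Γ(M, U)) :
    taylorStalk k M n x (M.presheaf.germ U x hx m) =
      (principalParts k M n).presheaf.germ U x hx
        (toPrincipalParts k M n U (PrincipalPartsModule.taylor k Γ(X, U) n Γ(M, U) m)) :=
  TopCat.Presheaf.stalkFunctor_map_germ_apply U x hx (taylor k M n) m

/-- The sheaf of differential operators of order at most `n` on `M`: the sheaf of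
`𝒪_X`-linear homomorphisms from the principal parts of order `n` of `M` to `M`. -/
abbrev diffOps : TopCat.Presheaf AddCommGrpCat.{u} X := sheafHom (principalParts k M n) M

/- In the following definitions `V` is a `k`-module with a `k`-linear map `ι` to the stalk `M_x`:
the inclusion of a subspace of `M_x`, or the map that takes germs of a space of sections. -/
variable {V : Type*} [AddCommGroup V] [Module k V] (ι : V →ₗ[k] M.presheaf.stalk x)

/-- The evaluation map from the stalk at `x` of the differential operators of order at most `n`
to `Hom_k(V, M_x)`: the operator given by `φ` sends `v` to `φ (1 ⊗ v)`. -/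
def evalMap : (diffOps k M n).stalk x →+ (V →ₗ[k] M.presheaf.stalk x) where
  toFun D := ((sheafHomStalk (principalParts k M n) M x D).restrictScalars k).comp
    ((taylorStalk k M n x).comp ι)
  map_zero' := by ext v; simp
  map_add' D E := by ext v; simp

/-- The map of fibres at `x` of the Taylor map of order `n` of `V`:
`c ⊗ v ↦ c ⊗ (1 ⊗ v)`, from `k_x ⊗[k] V` to the fibre at `x` of the principal parts. -/
def taylorFibre : IsLocalRing.ResidueField (X.presheaf.stalk x) ⊗[k] V
    →ₗ[IsLocalRing.ResidueField (X.presheaf.stalk x)]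
      IsLocalRing.ResidueField (X.presheaf.stalk x) ⊗[X.presheaf.stalk x]
        (principalParts k M n).presheaf.stalk x :=
  LinearMap.liftBaseChange (IsLocalRing.ResidueField (X.presheaf.stalk x))
    (((TensorProduct.mk (X.presheaf.stalk x) (IsLocalRing.ResidueField (X.presheaf.stalk x))
      ((principalParts k M n).presheaf.stalk x) 1).restrictScalars k).comp
        ((taylorStalk k M n x).comp ι))

lemma taylorFibre_tmul (c : IsLocalRing.ResidueField (X.presheaf.stalk x)) (v : V) :
    taylorFibre k M n x ι (c ⊗ₜ v) = c ⊗ₜ taylorStalk k M n x (ι v) := by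
  simp [taylorFibre, TensorProduct.smul_tmul']

/-- `V`, mapped to the stalk `M_x` by `ι`, is separated at `x`: the maps of fibres at `x` of the
Taylor maps of all sufficiently high orders are injective. -/
def IsSeparatedAt : Prop :=
  ∃ N : ℕ, ∀ n ≥ N, Function.Injective (taylorFibre k M n x ι)

/-- The injectivity order of `V` at `x`: the smallest `n` for which the map of fibres at `x` of
the Taylor map of order `n` is injective. -/
def injOrder : ℕ := sInf {n : ℕ | Function.Injective (taylorFibre k M n x ι)}

/-- The map from a space `V` of global sections of `M` to the stalk at `x`. -/
def globalGerm (V : Submodule k Γ(M, ⊤)) : V →ₗ[k] M.presheaf.stalk x :=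
  (germLinear k M ⊤ x (TopologicalSpace.Opens.mem_top x)).comp V.subtype

end PrincipalParts

end Modules

end AlgebraicGeometry.Scheme

end

noncomputable section

/-! ### Regular local rings -/

section RegularLocal

open IsLocalRing

/-! The equivalence "`W^n_x` surjective iff `d^n_V(x)` injective" holds for each `n` separately, and
the equality of minima follows. Write `A` for the local ring at `x` and `P` for the stalk of the
principal parts. Two facts reduce everything to linear algebra over `A`: `P` is finite free
(`finite_free_principalParts_stalk`), and every `A`-linear map `P → M_x` is the stalk of a
differential operator (`sheafHomStalk_principalParts_surjective`). So `W^n_x` is surjective iff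
every `k`-linear `V → M_x` extends along the Taylor map `V → P` to an `A`-linear map. If the Taylor
map is injective on fibres, then `A ⊗ V → P` is a split injection and extensions exist. Conversely,
extend the maps "`j`-th coordinate times `e`" with `e ∉ m M_x`; on the fibre they recover all
coordinates, so the kernel vanishes. If `M_x = 0` there is no such `e`, but then the Taylor maps are
zero and separatedness forces `k_x ⊗ V = 0`. Only a linear map `V → M_x` is needed, not an injective
one, so germs of global sections are covered too. Both facts come from local coordinates `x_i` with
dual derivations `∂_i`: the monomials of degree at most `n` in `1 ⊗ x_i - x_i ⊗ 1` span the
principal parts, and the operators `(1/α!) ∂^α` are dual to them, in characteristic zero. These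
operators live on an open neighbourhood, hence are germs of the Hom sheaf
(`exists_principalParts_stalk_basis`). Coordinates exist because regular points are smooth. For a
regular quotient `A = B/J` of a regular local ring `B` with maximal ideal `m`, one has `J ∩ m² ⊆ mJ`
(`inf_sq_le_mul`), so `J/mJ` embeds in `m/m²`; the latter embeds in the fibre of the differentials
of `B` because the residue field is formally smooth over `k`. This is the Jacobian criterion. -/

lemma IsLocalRing.spanFinrank_maximalIdeal_quotient_span_singleton_add_one_le {R : Type*}
    [CommRing R] [IsLocalRing R] [IsNoetherianRing R] {f : R} (hf : f ∈ maximalIdeal R)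
    (hf2 : f ∉ maximalIdeal R ^ 2) [IsLocalRing (R ⧸ Ideal.span {f})] :
    (maximalIdeal (R ⧸ Ideal.span {f})).spanFinrank + 1 ≤ (maximalIdeal R).spanFinrank := by
  set π := Ideal.Quotient.mk (Ideal.span {f})
  let v : CotangentSpace R := (maximalIdeal R).toCotangent ⟨f, hf⟩
  have hv : v ≠ 0 := by
    intro h
    exact hf2 ((Ideal.toCotangent_eq_zero _ _).mp h)
  let L : Submodule (ResidueField R) (CotangentSpace R) := Submodule.span _ {v}
  -- The class of `f` spans a line in the cotangent space. Lifts of a basis of the quotient by this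
  -- line generate the maximal ideal together with `f`, by Nakayama, so their images alone generate
  -- it modulo `f`.
  have hL : Module.finrank (ResidueField R) (CotangentSpace R ⧸ L) + 1 =
      Module.finrank (ResidueField R) (CotangentSpace R) := by
    rw [← L.finrank_quotient_add_finrank, finrank_span_singleton hv]
  rw [spanFinrank_maximalIdeal_eq_finrank_cotangentSpace R, ← hL, add_le_add_iff_right]
  set d := Module.finrank (ResidueField R) (CotangentSpace R ⧸ L)
  let b : Module.Basis (Fin d) (ResidueField R) (CotangentSpace R ⧸ L) := Module.finBasis _ _
  have hb (i : Fin d) : ∃ g : maximalIdeal R, L.mkQ ((maximalIdeal R).toCotangent g) = b i := by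
    obtain ⟨w, hw⟩ := L.mkQ_surjective (b i)
    obtain ⟨g, rfl⟩ := (maximalIdeal R).toCotangent_surjective w
    exact ⟨g, hw⟩
  choose g hg using hb
  have hspan : Submodule.span (ResidueField R)
      ((maximalIdeal R).toCotangent '' (insert ⟨f, hf⟩ (Set.range g))) = ⊤ := by
    rw [Set.image_insert_eq, Submodule.span_insert]
    have : (Submodule.span (ResidueField R)
        ((maximalIdeal R).toCotangent '' Set.range g)).map L.mkQ = ⊤ := by
      rw [Submodule.map_span, ← Set.range_comp, ← Set.range_comp, ← b.span_eq]
      congr 2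
      exact funext hg
    rw [sup_comm]
    exact (Submodule.map_mkQ_eq_top L _).mp this |> fun h => by rwa [sup_comm]
  rw [CotangentSpace.span_image_eq_top_iff] at hspan
  have hm : maximalIdeal R = Ideal.span {f} ⊔ Ideal.span (Set.range fun i => (g i : R)) := by
    have := congrArg (Submodule.map (maximalIdeal R).subtype) hspan
    rw [Submodule.map_subtype_top, Submodule.map_span, Set.image_insert_eq, ← Set.range_comp] at this
    refine this.symm.trans ?_
    rw [Submodule.span_insert]
    rfl
  have hm' : maximalIdeal (R ⧸ Ideal.span {f}) = Ideal.span (Set.range fun i => π (g i)) := by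
    refine (IsLocalRing.map_maximalIdeal_of_surjective π Ideal.Quotient.mk_surjective).symm.trans
      ((congrArg (Ideal.map π) hm).trans ?_)
    rw [Ideal.map_sup, Ideal.map_quotient_self, bot_sup_eq, Ideal.map_span, ← Set.range_comp]
    rfl
  rw [hm']
  refine (Submodule.spanFinrank_span_le_ncard_of_finite (Set.finite_range _)).trans ?_
  rw [← Set.image_univ]
  refine (Set.ncard_image_le Set.finite_univ).trans ?_
  simp

lemma WithBot.natCast_le_of_add_one_le_add_one {a : ℕ} {b : WithBot ℕ∞}
    (h : (a + 1 : WithBot ℕ∞) ≤ b + 1) : (a : WithBot ℕ∞) ≤ b := by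
  induction b with
  | bot => exact absurd h (by simp)
  | coe b =>
    induction b with
    | top => exact le_top
    | coe b => exact_mod_cast Nat.le_of_add_le_add_right (by exact_mod_cast h : a + 1 ≤ b + 1)

namespace IsRegularLocalRing

variable {R : Type*} [CommRing R] [IsRegularLocalRing R]

lemma isLocalRing_quotient_span_singleton {f : R} (hf : f ∈ maximalIdeal R) :
    IsLocalRing (R ⧸ Ideal.span {f}) := by
  have : Nontrivial (R ⧸ Ideal.span {f}) := Ideal.Quotient.nontrivial_iff.mpr fun h =>
    (Ideal.ne_top_iff_one _).mp (maximalIdeal.isMaximal R).ne_top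
      (((Ideal.span_singleton_le_iff_mem _).mpr hf) (h ▸ Submodule.mem_top))
  exact .of_surjective' _ Ideal.Quotient.mk_surjective

/-- The quotient of a regular local ring by an element of the maximal ideal that does not lie in
its square is regular, and its dimension drops by one. -/
lemma quotient_span_singleton {f : R} (hf : f ∈ maximalIdeal R) (hf2 : f ∉ maximalIdeal R ^ 2) :
    IsRegularLocalRing (R ⧸ Ideal.span {f}) ∧
      ringKrullDim (R ⧸ Ideal.span {f}) + 1 = ringKrullDim R := by
  have := isLocalRing_quotient_span_singleton hf
  have h1 := spanFinrank_maximalIdeal_quotient_span_singleton_add_one_le hf hf2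
  have h2 : ringKrullDim R ≤ ringKrullDim (R ⧸ Ideal.span {f}) + 1 := by
    rw [← maximalIdeal_height_eq_ringKrullDim]
    exact Ideal.height_le_ringKrullDim_quotient_add_one hf
  have h3 := ringKrullDim_le_spanFinrank_maximalIdeal (R ⧸ Ideal.span {f})
  have h4 := (isRegularLocalRing_iff R).mp ‹_›
  have h5 : ringKrullDim (R ⧸ Ideal.span {f}) + 1 ≤
      (maximalIdeal (R ⧸ Ideal.span {f})).spanFinrank + 1 := by gcongr
  have h6 : ((maximalIdeal (R ⧸ Ideal.span {f})).spanFinrank + 1 : WithBot ℕ∞) ≤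
      (maximalIdeal R).spanFinrank := by exact_mod_cast h1
  -- The chain `dim R ≤ dim R/f + 1 ≤ edim R/f + 1 ≤ edim R = dim R` consists of equalities.
  refine ⟨of_spanFinrank_maximalIdeal_le _ ?_, ?_⟩
  · have := (h6.trans (h4.le.trans h2))
    exact WithBot.natCast_le_of_add_one_le_add_one this
  · exact le_antisymm (h5.trans (h6.trans h4.le)) h2

lemma exists_ringKrullDim_eq_natCast (R : Type*) [CommRing R] [IsRegularLocalRing R] :
    ∃ n : ℕ, ringKrullDim R = n :=
  ⟨_, ((isRegularLocalRing_iff R).mp ‹_›).symm⟩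

/-- Induction on the dimension. Prime avoidance gives `x` in the maximal ideal, outside its square
and outside all minimal primes. The ring `R/x` is a domain by induction, so `(x)` is prime and
contains a minimal prime, which Nakayama shows to be zero. -/
lemma isDomain_of_ringKrullDim_eq (n : ℕ) : ∀ (R : Type u) [CommRing R] [IsRegularLocalRing R],
    ringKrullDim R = n → IsDomain R := by
  induction n with
  | zero =>
    intro R _ _ h
    have h1 : maximalIdeal R = ⊥ := by
      have h2 := (isRegularLocalRing_iff R).mp ‹_›
      rw [h] at h2
      have h3 : (maximalIdeal R).spanFinrank = 0 := by exact_mod_cast h2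
      exact (Submodule.spanFinrank_eq_zero_iff_eq_bot
        (maximalIdeal R).fg_of_isNoetherianRing).mp h3
    have := (isField_iff_maximalIdeal_eq.mpr h1)
    exact this.isDomain
  | succ n ih =>
    intro R _ _ h
    have hmin : ∀ q ∈ minimalPrimes R, ¬ maximalIdeal R ≤ q := by
      intro q hq hle
      have hq' : q.IsPrime := hq.1.1
      have heq : q = maximalIdeal R := le_antisymm (le_maximalIdeal hq'.ne_top) hle
      have h0 : q.height = 0 := Ideal.height_eq_zero_iff.mpr hq
      have := maximalIdeal_height_eq_ringKrullDim (R := R)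
      rw [← heq, h0, h] at this
      norm_cast at this
    have hm2 : ¬ maximalIdeal R ≤ maximalIdeal R ^ 2 := by
      intro hle
      have hbot : maximalIdeal R = ⊥ := by
        refine Submodule.eq_bot_of_le_smul_of_le_jacobson_bot (maximalIdeal R) _
          (maximalIdeal R).fg_of_isNoetherianRing ?_ (maximalIdeal_le_jacobson _)
        rwa [smul_eq_mul, ← pow_two]
      obtain ⟨q, hq, -⟩ := Ideal.exists_minimalPrimes_le (bot_le (a := maximalIdeal R))
      exact hmin q hq (hbot ▸ bot_le)
    have hfin := minimalPrimes.finite_of_isNoetherianRing R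
    obtain ⟨x, hx, hx2, hxq⟩ : ∃ x ∈ maximalIdeal R, x ∉ maximalIdeal R ^ 2 ∧
        ∀ q ∈ minimalPrimes R, x ∉ q := by
      by_contra! hcon
      have hsub : (maximalIdeal R : Set R) ⊆
          ⋃ i ∈ ((insert (maximalIdeal R ^ 2) hfin.toFinset : Finset (Ideal R)) : Set (Ideal R)),
            ((id i : Ideal R) : Set R) := by
        intro x hx
        by_cases hx2 : x ∈ maximalIdeal R ^ 2
        · exact Set.mem_biUnion (by simp) hx2
        · obtain ⟨q, hq, hxq⟩ := hcon x hx hx2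
          exact Set.mem_biUnion (by simp [hq]) hxq
      -- Prime avoidance tolerates two ideals that are not prime; the square of the maximal ideal
      -- fills both places.
      obtain ⟨i, hi, hle⟩ := (Ideal.subset_union_prime (maximalIdeal R ^ 2) (maximalIdeal R ^ 2)
        (fun i hi h1 _ => by
          simp only [Finset.mem_insert, Set.Finite.mem_toFinset] at hi
          exact (hi.resolve_left h1).1.1)).mp hsub
      simp only [Finset.mem_insert, Set.Finite.mem_toFinset] at hi
      rcases hi with rfl | hi
      · exact hm2 hle
      · exact hmin i hi hle
    obtain ⟨hreg, hdim⟩ := quotient_span_singleton hx hx2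
    have hdim' : ringKrullDim (R ⧸ Ideal.span {x}) = n := by
      obtain ⟨m, hm⟩ := exists_ringKrullDim_eq_natCast (R ⧸ Ideal.span {x})
      rw [hm, h] at hdim
      rw [hm]
      have : m + 1 = n + 1 := by exact_mod_cast hdim
      rw [Nat.succ_injective this]
    have hdom := ih _ hdim'
    have hprime : (Ideal.span {x}).IsPrime := (Ideal.Quotient.isDomain_iff_prime _).mp hdom
    obtain ⟨q, hq, hqx⟩ := Ideal.exists_minimalPrimes_le (bot_le (a := Ideal.span {x}))
    have hqp : q.IsPrime := hq.1.1
    -- An element of `q` has the form `a * x`, and `x ∉ q` forces `a ∈ q`; hence `q` equals its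
    -- product with the maximal ideal.
    have hq0 : q = ⊥ := by
      refine Submodule.eq_bot_of_le_smul_of_le_jacobson_bot (maximalIdeal R) _
        q.fg_of_isNoetherianRing ?_ (maximalIdeal_le_jacobson _)
      intro y hy
      obtain ⟨a, rfl⟩ := Ideal.mem_span_singleton'.mp (hqx hy)
      rw [mul_comm]
      exact Submodule.smul_mem_smul hx ((hqp.mem_or_mem hy).resolve_right (hxq q hq))
    rw [hq0] at hqp
    exact IsDomain.of_bot_isPrime R

/-- A regular local ring is a domain. -/
lemma isDomain (R : Type u) [CommRing R] [IsRegularLocalRing R] : IsDomain R := by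
  obtain ⟨n, hn⟩ := exists_ringKrullDim_eq_natCast R
  exact isDomain_of_ringKrullDim_eq n R hn

/-- Since `J` lies in the square of the maximal ideal, lifts of minimal generators of the maximal
ideal of `R/J` already generate that of `R`, by Nakayama. So the embedding dimension does not drop,
and by regularity of both rings neither does the dimension. -/
lemma ringKrullDim_quotient_eq_of_le_sq {R : Type*} [CommRing R] [IsRegularLocalRing R]
    {J : Ideal R} (hJ : J ≤ maximalIdeal R ^ 2) [IsRegularLocalRing (R ⧸ J)] :
    ringKrullDim R ≤ ringKrullDim (R ⧸ J) := by
  set π := Ideal.Quotient.mk J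
  have hfg := (maximalIdeal (R ⧸ J)).fg_of_isNoetherianRing
  have hgen (g : (maximalIdeal (R ⧸ J)).generators) : ∃ r : R, π r = g :=
    Ideal.Quotient.mk_surjective _
  choose r hr using hgen
  have hmap : (Ideal.span (Set.range r)).map π = maximalIdeal (R ⧸ J) := by
    rw [Ideal.map_span, ← Set.range_comp]
    refine Eq.trans ?_ (maximalIdeal (R ⧸ J)).span_generators
    rw [show π ∘ r = Subtype.val from funext hr, Subtype.range_val]
  have hle : maximalIdeal R ≤ Ideal.span (Set.range r) := by
    refine Submodule.le_of_le_smul_of_le_jacobson_bot (I := maximalIdeal R)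
      (maximalIdeal R).fg_of_isNoetherianRing (maximalIdeal_le_jacobson _) ?_
    rw [smul_eq_mul, ← pow_two]
    intro y hy
    have hy' : π y ∈ (Ideal.span (Set.range r)).map π := by
      rw [hmap, ← IsLocalRing.map_maximalIdeal_of_surjective π Ideal.Quotient.mk_surjective]
      exact Ideal.mem_map_of_mem _ hy
    obtain ⟨z, hz, hzy⟩ := (Ideal.mem_map_iff_of_surjective π Ideal.Quotient.mk_surjective).mp hy'
    refine Submodule.mem_sup.mpr ⟨z, hz, y - z, hJ ?_, by ring⟩
    exact Ideal.Quotient.eq.mp hzy.symm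
  have hge : Ideal.span (Set.range r) ≤ maximalIdeal R := by
    refine le_maximalIdeal fun h => ?_
    rw [h, Ideal.map_top] at hmap
    exact (maximalIdeal.isMaximal (R ⧸ J)).ne_top hmap.symm
  have hfin : Finite (maximalIdeal (R ⧸ J)).generators := Submodule.FG.finite_generators hfg
  rw [← (isRegularLocalRing_iff R).mp ‹_›, ← (isRegularLocalRing_iff (R ⧸ J)).mp ‹_›,
    le_antisymm hle hge, Nat.cast_le, ← Submodule.FG.generators_ncard hfg]
  refine (Submodule.spanFinrank_span_le_ncard_of_finite (Set.finite_range r)).trans ?_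
  rw [← Set.image_univ, ← Set.ncard_univ (α := (maximalIdeal (R ⧸ J)).generators) |>.trans
    (Nat.card_coe_set_eq _)]
  exact Set.ncard_image_le Set.finite_univ

/-- If `J ⊆ m²`, then `R/J` has at least the dimension of `R`; as a nonzero element of the domain
`R` lowers the dimension, `J = 0`. Otherwise some `f ∈ J` lies outside `m²`, and induction applies
to `R/f`. -/
lemma inf_sq_le_mul_of_ringKrullDim_eq (n : ℕ) : ∀ (R : Type u) [CommRing R]
    [IsRegularLocalRing R] (J : Ideal R), IsRegularLocalRing (R ⧸ J) → ringKrullDim R = n →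
      J ⊓ maximalIdeal R ^ 2 ≤ maximalIdeal R * J := by
  induction n with
  | zero =>
    intro R _ _ J _ h
    have h2 := (isRegularLocalRing_iff R).mp ‹_›
    rw [h] at h2
    have h3 : (maximalIdeal R).spanFinrank = 0 := by exact_mod_cast h2
    rw [(Submodule.spanFinrank_eq_zero_iff_eq_bot
      (maximalIdeal R).fg_of_isNoetherianRing).mp h3]
    simp
  | succ n ih =>
    intro R _ _ J hreg h
    have hdom := isDomain R
    have hJm : J ≤ maximalIdeal R := le_maximalIdeal
      (Ideal.Quotient.nontrivial_iff.mp inferInstance)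
    by_cases hJ : J ≤ maximalIdeal R ^ 2
    · have hle := ringKrullDim_quotient_eq_of_le_sq hJ
      suffices hbot : J = ⊥ by simp [hbot]
      by_contra hne
      obtain ⟨r, hr, hr0⟩ := Submodule.exists_mem_ne_zero_of_ne_bot hne
      have h1 := ringKrullDim_quotient_succ_le_of_nonZeroDivisor
        (mem_nonZeroDivisors_of_ne_zero hr0)
      have h2 : ringKrullDim (R ⧸ J) ≤ ringKrullDim (R ⧸ Ideal.span {r}) :=
        ringKrullDim_le_of_surjective
          (Ideal.Quotient.factor ((Ideal.span_singleton_le_iff_mem _).mpr hr))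
          (Ideal.Quotient.factor_surjective _)
      obtain ⟨m, hm⟩ := exists_ringKrullDim_eq_natCast (R ⧸ J)
      have h3 : ringKrullDim (R ⧸ J) + 1 ≤ ringKrullDim (R ⧸ J) :=
        ((by gcongr : _ ≤ ringKrullDim (R ⧸ Ideal.span {r}) + 1).trans h1).trans hle
      rw [hm] at h3
      have : m + 1 ≤ m := by exact_mod_cast h3
      omega
    · obtain ⟨f, hfJ, hf2⟩ := SetLike.not_le_iff_exists.mp hJ
      obtain ⟨hreg', hdim⟩ := quotient_span_singleton (hJm hfJ) hf2
      set π := Ideal.Quotient.mk (Ideal.span {f})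
      have hdim' : ringKrullDim (R ⧸ Ideal.span {f}) = n := by
        obtain ⟨m, hm⟩ := exists_ringKrullDim_eq_natCast (R ⧸ Ideal.span {f})
        rw [hm, h] at hdim
        rw [hm]
        have : m + 1 = n + 1 := by exact_mod_cast hdim
        rw [Nat.succ_injective this]
      have hregq : IsRegularLocalRing ((R ⧸ Ideal.span {f}) ⧸ J.map π) :=
        of_ringEquiv (DoubleQuot.quotQuotEquivQuotOfLE
          ((Ideal.span_singleton_le_iff_mem _).mpr hfJ)).symm
      have hI := ih _ (J.map π) hregq hdim'
      have hmπ : maximalIdeal (R ⧸ Ideal.span {f}) = (maximalIdeal R).map π :=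
        (IsLocalRing.map_maximalIdeal_of_surjective π Ideal.Quotient.mk_surjective).symm
      rintro g ⟨hgJ, hg2⟩
      have hg : π g ∈ (maximalIdeal R * J).map π := by
        rw [Ideal.map_mul, ← hmπ]
        refine hI ⟨Ideal.mem_map_of_mem _ hgJ, ?_⟩
        rw [hmπ, ← Ideal.map_pow]
        exact Ideal.mem_map_of_mem _ hg2
      obtain ⟨z, hz, hzg⟩ := (Ideal.mem_map_iff_of_surjective π Ideal.Quotient.mk_surjective).mp hg
      obtain ⟨a, ha⟩ := Ideal.mem_span_singleton'.mp (Ideal.Quotient.eq.mp hzg.symm)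
      have hz2 : z ∈ maximalIdeal R ^ 2 := by
        rw [pow_two]; exact Ideal.mul_mono_right hJm hz
      -- Here `a * f = g - z` lies in `m²`; a unit `a` would put `f` there too.
      have ham : a ∈ maximalIdeal R := by
        by_contra hcon
        have hu : IsUnit a := by
          rwa [mem_maximalIdeal, mem_nonunits_iff, not_not] at hcon
        exact hf2 ((Ideal.unit_mul_mem_iff_mem _ hu).mp (ha ▸ Ideal.sub_mem _ hg2 hz2))
      have : g = z + a * f := by rw [ha]; ring
      rw [this]
      exact Ideal.add_mem _ hz (Ideal.mul_mem_mul ham hfJ)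

/-- If a quotient `R ⧸ J` of a regular local ring is regular, then the elements of `J` that lie in
the square of the maximal ideal `m` lie in `m * J`. -/
lemma inf_sq_le_mul (R : Type u) [CommRing R] [IsRegularLocalRing R] (J : Ideal R)
    [IsRegularLocalRing (R ⧸ J)] : J ⊓ maximalIdeal R ^ 2 ≤ maximalIdeal R * J := by
  obtain ⟨n, hn⟩ := exists_ringKrullDim_eq_natCast R
  exact inf_sq_le_mul_of_ringKrullDim_eq n R J ‹_› hn


end IsRegularLocalRing

/-! ### Regularity implies smoothness over a perfect field. -/

lemma TensorProduct.one_tmul_eq_zero_iff {B L N : Type*} [CommRing B] [CommRing L] [Algebra B L]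
    [AddCommGroup N] [Module B N] (h : Function.Surjective (algebraMap B L)) {y : N} :
    (1 : L) ⊗ₜ[B] y = 0 ↔ y ∈ RingHom.ker (algebraMap B L) • (⊤ : Submodule B N) := by
  let e : (B ⧸ RingHom.ker (algebraMap B L)) ≃ₗ[B] L :=
    (Ideal.quotientKerAlgEquivOfSurjective (f := Algebra.ofId B L) h).toLinearEquiv
  have he : e 1 = 1 := map_one (Ideal.quotientKerAlgEquivOfSurjective (f := Algebra.ofId B L) h)
  rw [← Submodule.Quotient.mk_eq_zero, ← TensorProduct.quotTensorEquivQuotSMul_mk_one_tmul,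
    LinearEquiv.map_eq_zero_iff, ← he]
  exact (TensorProduct.congr e (LinearEquiv.refl B N)).map_eq_zero_iff (x := 1 ⊗ₜ y)

open KaehlerDifferential in
/-- A regular quotient of a regular local algebra that is formally smooth and essentially of finite
type over a perfect field is formally smooth. -/
lemma Algebra.FormallySmooth.of_isRegularLocalRing_of_surjective {k : Type*} {B A : Type u}
    [Field k] [PerfectField k] [CommRing B] [CommRing A] [Algebra k B] [Algebra k A] [Algebra B A]
    [IsScalarTower k B A] [IsRegularLocalRing B] [IsRegularLocalRing A]
    [Algebra.EssFiniteType k B] [Algebra.FormallySmooth k B]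
    (h : Function.Surjective (algebraMap B A)) : Algebra.FormallySmooth k A := by
  have : Module.Finite B Ω[B⁄k] := inferInstance
  have : Module.Projective B Ω[B⁄k] := inferInstance
  have : Module.Free B Ω[B⁄k] := Module.free_of_flat_of_isLocalRing
  have hsurj : Function.Surjective (algebraMap B (ResidueField A)) :=
    Ideal.Quotient.mk_surjective.comp h
  have : Algebra.EssFiniteType B (ResidueField A) :=
    have := Algebra.FiniteType.of_surjective (Algebra.ofId B (ResidueField A)) hsurj
    inferInstance
  have : Algebra.EssFiniteType k (ResidueField A) := Algebra.EssFiniteType.comp k B _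
  have hL : Algebra.FormallySmooth k (ResidueField A) := inferInstance
  -- The Jacobian criterion is used twice: for `B → κ` it turns formal smoothness of the residue
  -- field into an injectivity statement, and for `B → A` the corresponding injectivity is the goal.
  rw [Algebra.FormallySmooth.iff_injective_cotangentComplexBaseChange B (ResidueField A) hsurj
    (IsNoetherian.noetherian _) (by simp [IsLocalRing.maximalIdeal_eq_bot])] at hL
  rw [Algebra.FormallySmooth.iff_injective_cotangentComplexBaseChange_residueField B h
    (IsNoetherian.noetherian _)]
  have hker : RingHom.ker (algebraMap B (ResidueField A)) = maximalIdeal B := by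
    have : (RingHom.ker (algebraMap B (ResidueField A))).IsMaximal :=
      RingHom.ker_isMaximal_of_surjective _ hsurj
    exact IsLocalRing.eq_maximalIdeal this
  have hregq : IsRegularLocalRing (B ⧸ RingHom.ker (algebraMap B A)) :=
    .of_ringEquiv (RingHom.quotientKerEquivOfSurjective h).symm
  have hpure (N : Submodule B B) (z : ResidueField A ⊗[B] N) : ∃ y : N, z = 1 ⊗ₜ y := by
    induction z using TensorProduct.induction_on with
    | zero => exact ⟨0, by simp⟩
    | tmul c y =>
      obtain ⟨b, rfl⟩ := hsurj c
      exact ⟨b • y, by rw [← TensorProduct.smul_tmul, Algebra.algebraMap_eq_smul_one]⟩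
    | add x y hx hy =>
      obtain ⟨x, rfl⟩ := hx
      obtain ⟨y, rfl⟩ := hy
      exact ⟨x + y, by rw [TensorProduct.tmul_add]⟩
  rw [injective_iff_map_eq_zero]
  intro z hz
  obtain ⟨⟨f, hf⟩, rfl⟩ := hpure _ z
  have hfm : f ∈ RingHom.ker (algebraMap B (ResidueField A)) := by
    rw [RingHom.mem_ker, IsScalarTower.algebraMap_apply B A (ResidueField A), RingHom.mem_ker.mp hf,
      map_zero]
  -- An `f ∈ J` with vanishing differential on the fibre lies in `m²` by the criterion for `κ`; then
  -- `J ∩ m² ⊆ mJ` kills its class.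
  have h0 : (1 : ResidueField A) ⊗ₜ[B] (⟨f, hfm⟩ : RingHom.ker (algebraMap B (ResidueField A))) =
      0 := by
    apply hL
    rw [map_zero, cotangentComplexBaseChange_tmul]
    rw [cotangentComplexBaseChange_tmul] at hz
    exact hz
  rw [TensorProduct.one_tmul_eq_zero_iff hsurj, Submodule.mem_smul_top_iff] at h0 ⊢
  nth_rw 1 [hker] at h0 ⊢
  refine IsRegularLocalRing.inf_sq_le_mul B (RingHom.ker (algebraMap B A)) ⟨hf, ?_⟩
  rw [pow_two]
  exact Ideal.mul_mono_right hker.le h0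

/-- A finitely generated algebra over a field of characteristic zero is standard smooth in a
neighbourhood of every regular point. -/
lemma Algebra.exists_isStandardSmooth_of_isRegularLocalRing {k R : Type u} [Field k] [CharZero k]
    [CommRing R] [Algebra k R] [Algebra.FiniteType k R] (p : Ideal R) [p.IsPrime]
    [IsRegularLocalRing (Localization.AtPrime p)] :
    ∃ f ∉ p, Algebra.IsStandardSmooth k (Localization.Away f) := by
  obtain ⟨n, φ, hφ⟩ := Algebra.FiniteType.iff_quotient_mvPolynomial''.mp
    (inferInstance : Algebra.FiniteType k R)
  let q : Ideal (MvPolynomial (Fin n) k) := p.comap φ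
  let : Algebra (MvPolynomial (Fin n) k) R := φ.toRingHom.toAlgebra
  let : Algebra (Localization.AtPrime q) (Localization.AtPrime p) :=
    (Localization.localRingHom q p φ.toRingHom rfl).toAlgebra
  have hsurj : Function.Surjective
      (algebraMap (Localization.AtPrime q) (Localization.AtPrime p)) :=
    RingHom.surjective_localRingHom_of_surjective φ.toRingHom hφ p
  have : IsScalarTower k (Localization.AtPrime q) (Localization.AtPrime p) :=
    .of_algebraMap_eq fun c => by
      rw [IsScalarTower.algebraMap_apply k (MvPolynomial (Fin n) k) (Localization.AtPrime q),
        IsScalarTower.algebraMap_apply k R (Localization.AtPrime p)]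
      refine Eq.trans ?_ (Localization.localRingHom_to_map q p φ.toRingHom rfl _).symm
      congr 1
      exact (φ.commutes c).symm
  have : Algebra.FormallySmooth k (Localization.AtPrime q) :=
    have : Algebra.FormallySmooth (MvPolynomial (Fin n) k) (Localization.AtPrime q) :=
      .of_isLocalization q.primeCompl
    .comp k (MvPolynomial (Fin n) k) _
  have : Algebra.EssFiniteType k (Localization.AtPrime q) :=
    have : Algebra.EssFiniteType (MvPolynomial (Fin n) k) (Localization.AtPrime q) :=
      .of_isLocalization _ q.primeCompl
    .comp k (MvPolynomial (Fin n) k) _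
  -- The local ring at `p` is a quotient of a local ring of affine space, which is regular and
  -- formally smooth over `k`.
  have : IsRegularLocalRing (Localization.AtPrime q) := inferInstance
  have : Algebra.IsSmoothAt k p :=
    Algebra.FormallySmooth.of_isRegularLocalRing_of_surjective hsurj
  have : Algebra.FinitePresentation k R := Algebra.FinitePresentation.of_finiteType.mp ‹_›
  exact Algebra.IsSmoothAt.exists_notMem_isStandardSmooth k p

end RegularLocal

/-! ### Coordinates and partial derivations -/

/-- A family `x` of elements of `R` and a family `d` of derivations of `R` over `k` form a system
of coordinates if the differentials of the `x i` generate the Kähler differentials and the `d i` are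
dual to them. -/
structure IsCoordinates {k R ι : Type*} [CommRing k] [CommRing R] [Algebra k R] (x : ι → R)
    (d : ι → Derivation k R R) : Prop where
  apply_self (i : ι) : d i (x i) = 1
  apply_of_ne {i j : ι} (h : i ≠ j) : d i (x j) = 0
  span_eq_top : Submodule.span R (Set.range fun i => KaehlerDifferential.D k R (x i)) = ⊤

namespace IsCoordinates

open KaehlerDifferential

variable {k R ι : Type*} [CommRing k] [CommRing R] [Algebra k R] {x : ι → R}
  {d : ι → Derivation k R R}

lemma of_basis (b : Module.Basis ι R Ω[R⁄k]) (hb : ∀ i, b i = D k R (x i)) :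
    IsCoordinates x fun i => (b.coord i).compDer (D k R) where
  apply_self i := by
    change b.coord i (D k R (x i)) = 1
    rw [← hb]; simp
  apply_of_ne {i j} h := by
    change b.coord i (D k R (x j)) = 0
    rw [← hb]; simp [h]
  span_eq_top := by
    rw [← b.span_eq]
    congr 2
    exact funext fun i => (hb i).symm

section Functoriality

variable {R' : Type*} [CommRing R'] [Algebra k R']

/-- Partial derivations with respect to coordinates commute with homomorphisms that preserve the
coordinates. -/
lemma map_apply (h : IsCoordinates x d) {x' : ι → R'} {d' : ι → Derivation k R' R'}
    (h' : IsCoordinates x' d') (σ : R →ₐ[k] R') (hσ : ∀ i, σ (x i) = x' i) (i : ι) (a : R) :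
    σ (d i a) = d' i (σ a) := by
  let : Algebra R R' := σ.toRingHom.toAlgebra
  have hsm (r : R) (s : R') : r • s = σ r * s := rfl
  have : IsScalarTower k R R' := .of_algebraMap_eq fun c => (σ.commutes c).symm
  -- Both sides are derivations from `R` to `R'`, so it suffices to compare them on the coordinates,
  -- whose differentials span.
  let d₁ : Derivation k R R' := (Algebra.linearMap R R').compDer (d i)
  let d₂ : Derivation k R R' := Derivation.mk' ((d' i).toLinearMap.comp σ.toLinearMap)
    (fun a b => by simp [hsm])
  have h12 : d₁.liftKaehlerDifferential = d₂.liftKaehlerDifferential := by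
    apply LinearMap.ext_on h.span_eq_top
    rintro _ ⟨j, rfl⟩
    simp only [Derivation.liftKaehlerDifferential_comp_D]
    change σ (d i (x j)) = d' i (σ (x j))
    rw [hσ]
    by_cases hij : i = j
    · subst hij
      rw [h.apply_self, h'.apply_self, map_one]
    · rw [h.apply_of_ne hij, h'.apply_of_ne hij, map_zero]
  have := congrArg (fun f => f (D k R a)) h12
  simp only [Derivation.liftKaehlerDifferential_comp_D] at this
  exact this

/-- Coordinates extend to formally étale algebras, in particular to localizations. -/
lemma exists_of_formallyEtale (h : IsCoordinates x d) [Algebra R R'] [IsScalarTower k R R']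
    [Algebra.FormallyEtale R R'] :
    ∃ d' : ι → Derivation k R' R', IsCoordinates (fun i => algebraMap R R' (x i)) d' := by
  let e := tensorKaehlerEquivOfFormallyEtale k R R'
  -- Formal étaleness identifies the differentials of `R'` with the base change of those of `R`, so
  -- the dual functionals extend by scalars.
  let f (i : ι) : Ω[R'⁄k] →ₗ[R'] R' := (LinearMap.liftBaseChange R'
    ((Algebra.linearMap R R').comp (d i).liftKaehlerDifferential)).comp e.symm.toLinearMap
  have hf (i : ι) (a : R) : (f i) (D k R' (algebraMap R R' a)) = algebraMap R R' (d i a) := by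
    change (LinearMap.liftBaseChange R' _) (e.symm _) = _
    rw [tensorKaehlerEquivOfFormallyEtale_symm_D_algebraMap]
    simp
  refine ⟨fun i => (f i).compDer (D k R'), fun i => ?_, fun {i j} hij => ?_, ?_⟩
  · exact (hf i _).trans (by rw [h.apply_self, map_one])
  · exact (hf i _).trans (by rw [h.apply_of_ne hij, map_zero])
  · have h1 := congrArg (Submodule.map e.toLinearMap) ((Submodule.baseChange_span (A := R')
      (Set.range fun i => D k R (x i))).symm.trans
        ((congrArg _ h.span_eq_top).trans (Submodule.baseChange_top R')))
    rw [Submodule.map_span, Submodule.map_top, LinearEquiv.range, ← Set.range_comp,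
      ← Set.range_comp] at h1
    rw [← h1]
    congr 2
    ext i
    simp [e]

end Functoriality

end IsCoordinates

/-! ### Derivations acting on the second tensor factor. -/

namespace Derivation

variable {k R : Type*} [CommRing k] [CommRing R] [Algebra k R]

/-- The derivation `1 ⊗ d` of `R ⊗[k] R` over `R`. -/
def lTensorSelf (d : Derivation k R R) : Derivation R (R ⊗[k] R) (R ⊗[k] R) :=
  Derivation.mk' (LinearMap.baseChange R d.toLinearMap) fun z w => by
    induction z using TensorProduct.induction_on with
    | zero => simp
    | add z z' hz hz' =>
      simp only [add_mul, map_add, smul_eq_mul, mul_add] at hz hz' ⊢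
      rw [hz, hz']
      ring
    | tmul a b =>
      induction w using TensorProduct.induction_on with
      | zero => simp
      | add w w' hw hw' =>
        simp only [add_mul, map_add, smul_eq_mul, mul_add] at hw hw' ⊢
        rw [hw, hw']
        ring
      | tmul a' b' =>
        simp [TensorProduct.tmul_add, mul_comm a a']

lemma lTensorSelf_tmul (d : Derivation k R R) (a b : R) :
    d.lTensorSelf (a ⊗ₜ b) = a ⊗ₜ d b := rfl

/-- The Leibniz rule differentiates one factor at a time, so only one power is lost. This is why an
operator of order at most `n` factors through the principal parts of order `n`. -/
lemma apply_mem_pow_of_mem_pow_succ {A S : Type*} [CommRing A] [CommRing S] [Algebra A S]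
    (d : Derivation A S S) (I : Ideal S) (n : ℕ) {z : S} (hz : z ∈ I ^ (n + 1)) : d z ∈ I ^ n := by
  induction n generalizing z with
  | zero => simp
  | succ n ih =>
    rw [pow_succ] at hz
    induction hz using Submodule.mul_induction_on' with
    | mem_mul_mem a ha b hb =>
      rw [d.leibniz, smul_eq_mul, smul_eq_mul]
      refine Ideal.add_mem _ (Ideal.mul_mem_right _ _ ha) ?_
      rw [pow_succ']
      exact Ideal.mul_mem_mul hb (ih ha)
    | add a _ b _ ha hb => rw [map_add]; exact Ideal.add_mem _ ha hb

end Derivation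

/-! ### Taylor polynomials in the increments of the coordinates. -/

namespace PrincipalParts

open KaehlerDifferential MvPolynomial

section Delta

variable (k : Type*) {R ι : Type*} [CommRing k] [CommRing R] [Algebra k R]

/-- The homomorphism `R[T] → R ⊗[k] R`, linear for the left structure, that sends `T i` to
`1 ⊗ x i - x i ⊗ 1`. -/
def evalDelta (x : ι → R) : MvPolynomial ι R →ₐ[R] R ⊗[k] R :=
  aeval fun i => (1 : R) ⊗ₜ[k] x i - x i ⊗ₜ[k] (1 : R)

variable {k}

lemma lmul'_evalDelta (x : ι → R) (p : MvPolynomial ι R) :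
    Algebra.TensorProduct.lmul' k (evalDelta k x p) = constantCoeff p := by
  induction p using MvPolynomial.induction_on with
  | C a => simp [evalDelta, Algebra.TensorProduct.algebraMap_apply]
  | add p q hp hq => rw [map_add, map_add, hp, hq, map_add]
  | mul_X p i hp => rw [map_mul, map_mul, hp, map_mul]; simp [evalDelta]

/-- The operator `1 ⊗ d i` is linear over the left factor, where the coefficients live, and sends
the `j`-th increment to the Kronecker delta. It therefore acts as the formal partial derivative. -/
lemma lTensorSelf_evalDelta {x : ι → R} {d : ι → Derivation k R R} (h : IsCoordinates x d) (i : ι)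
    (p : MvPolynomial ι R) :
    (d i).lTensorSelf (evalDelta k x p) = evalDelta k x (pderiv i p) := by
  classical
  induction p using MvPolynomial.induction_on with
  | C a =>
    rw [pderiv_C, map_zero, ← MvPolynomial.algebraMap_eq, AlgHom.commutes, Derivation.map_algebraMap]
  | add p q hp hq => simp only [map_add, hp, hq]
  | mul_X p j hp =>
    have hX : (d i).lTensorSelf (evalDelta k x (X j)) = evalDelta k x (pderiv i (X j)) := by
      rw [pderiv_X]
      by_cases hij : i = j
      · subst hij
        simp [evalDelta, Derivation.lTensorSelf_tmul, h.apply_self,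
          Algebra.TensorProduct.one_def]
      · simp [evalDelta, Derivation.lTensorSelf_tmul, h.apply_of_ne hij, Ne.symm hij]
    rw [map_mul, Derivation.leibniz, Derivation.leibniz, map_add, hp, hX]
    simp only [smul_eq_mul, map_mul]

/-- The composition of the operators `1 ⊗ d i`, for `i` in a list. -/
def lTensorList (d : ι → Derivation k R R) (l : List ι) : Module.End R (R ⊗[k] R) :=
  (l.map fun i => ((d i).lTensorSelf : R ⊗[k] R →ₗ[R] R ⊗[k] R)).prod

/-- The composition of the derivations `d i`, for `i` in a list. -/
def derivationList (d : ι → Derivation k R R) (l : List ι) : Module.End k R :=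
  (l.map fun i => (d i : R →ₗ[k] R)).prod

lemma lTensorList_tmul (d : ι → Derivation k R R) (l : List ι) (a b : R) :
    lTensorList d l (a ⊗ₜ b) = a ⊗ₜ derivationList d l b := by
  induction l with
  | nil => simp [lTensorList, derivationList]
  | cons i l ih =>
    simp only [lTensorList, derivationList, List.map_cons, List.prod_cons, Module.End.mul_apply] at *
    rw [ih]
    rfl

lemma lTensorList_mem (d : ι → Derivation k R R) (l : List ι) (n : ℕ) {z : R ⊗[k] R}
    (hz : z ∈ ideal k R ^ (n + l.length)) : lTensorList d l z ∈ ideal k R ^ n := by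
  induction l generalizing n with
  | nil => simpa [lTensorList] using hz
  | cons i l ih =>
    simp only [lTensorList, List.map_cons, List.prod_cons, Module.End.mul_apply] at *
    refine Derivation.apply_mem_pow_of_mem_pow_succ (d i).lTensorSelf _ _ (ih (n + 1) ?_)
    rwa [List.length_cons, ← add_assoc, add_right_comm] at hz

/-- The factor by which the composition of the partial derivatives in a list multiplies the
coefficients of a polynomial. -/
def coeffFactor : List ι → (ι →₀ ℕ) → ℕ
  | [], _ => 1
  | i :: l, γ => coeffFactor l (γ + Finsupp.single i 1) * (γ i + 1)

lemma coeffFactor_ne_zero (l : List ι) (γ : ι →₀ ℕ) : coeffFactor l γ ≠ 0 := by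
  induction l generalizing γ with
  | nil => exact one_ne_zero
  | cons i l ih => exact mul_ne_zero (ih _) (Nat.succ_ne_zero _)

/-- Only one coefficient of the iterated derivative matters, so the polynomial stays existential.
The exponent `γ` is arbitrary because each derivative raises it in the induction; for `γ = 0` the
factor is `α!`. -/
lemma exists_lTensorList_evalDelta [DecidableEq ι] {x : ι → R} {d : ι → Derivation k R R}
    (h : IsCoordinates x d) (l : List ι) (γ : ι →₀ ℕ) (p : MvPolynomial ι R) :
    ∃ q : MvPolynomial ι R, lTensorList d l (evalDelta k x p) = evalDelta k x q ∧
      coeff γ q = coeffFactor l γ * coeff (γ + Multiset.toFinsupp (l : Multiset ι)) p := by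
  induction l generalizing γ with
  | nil => exact ⟨p, by simp [lTensorList], by simp [coeffFactor]⟩
  | cons i l ih =>
    obtain ⟨q, hq, hqc⟩ := ih (γ + Finsupp.single i 1)
    refine ⟨pderiv i q, ?_, ?_⟩
    · rw [← lTensorSelf_evalDelta h, ← hq]
      simp [lTensorList]
    · rw [coeff_pderiv, hqc, ← Multiset.cons_coe, ← Multiset.singleton_add, map_add,
        Multiset.toFinsupp_singleton, add_assoc, coeffFactor]
      push_cast
      ring

end Delta

section Dual

variable {k R ι : Type*} [Field k] [CommRing R] [Algebra k R]

/-- The functional on `R ⊗[k] R` given by the differential operator `(1 / α!) d ^ α`. -/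
def dualOp (d : ι → Derivation k R R) (α : ι →₀ ℕ) : R ⊗[k] R →ₗ[R] R :=
  (coeffFactor α.toMultiset.toList 0 : k)⁻¹ •
    (Algebra.TensorProduct.lmul'' k (S := R)).toLinearMap ∘ₗ lTensorList d α.toMultiset.toList

lemma dualOp_tmul (d : ι → Derivation k R R) (α : ι →₀ ℕ) (a b : R) :
    dualOp d α (a ⊗ₜ b) = (coeffFactor α.toMultiset.toList 0 : k)⁻¹ •
      (a * derivationList d α.toMultiset.toList b) := by
  rw [dualOp, LinearMap.smul_apply, LinearMap.comp_apply, lTensorList_tmul]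
  rfl

/-- At most `n` derivations leave an element of `I ^ (n + 1)` inside `I`, which multiplication
kills. -/
lemma dualOp_of_mem (d : ι → Derivation k R R) {α : ι →₀ ℕ} {n : ℕ} (hα : α.degree ≤ n)
    {z : R ⊗[k] R} (hz : z ∈ ideal k R ^ (n + 1)) : dualOp d α z = 0 := by
  rw [dualOp, LinearMap.smul_apply, LinearMap.comp_apply]
  have h1 : lTensorList d α.toMultiset.toList z ∈ ideal k R ^ 1 := by
    refine lTensorList_mem d _ 1 (Ideal.pow_le_pow_right ?_ hz)
    rw [Multiset.length_toList, Finsupp.card_toMultiset, add_comm]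
    exact Nat.add_le_add_right hα 1
  rw [pow_one, RingHom.mem_ker] at h1
  exact (congrArg _ h1).trans (smul_zero _)

/-- Multiplication reads off the constant term of the iterated derivative, which is `α!` times the
coefficient; characteristic zero makes `α!` invertible. -/
lemma dualOp_evalDelta [CharZero k] {x : ι → R} {d : ι → Derivation k R R}
    (h : IsCoordinates x d) (α : ι →₀ ℕ) (p : MvPolynomial ι R) :
    dualOp d α (evalDelta k x p) = coeff α p := by
  classical
  obtain ⟨q, hq, hqc⟩ := exists_lTensorList_evalDelta h α.toMultiset.toList 0 p
  rw [dualOp, LinearMap.smul_apply, LinearMap.comp_apply, hq]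
  refine (congrArg _ ((lmul'_evalDelta x q).trans hqc)).trans ?_
  rw [zero_add, Multiset.coe_toList, Finsupp.toMultiset_toFinsupp, ← nsmul_eq_mul,
    ← Nat.cast_smul_eq_nsmul k, smul_smul, inv_mul_cancel₀, one_smul]
  exact_mod_cast coeffFactor_ne_zero _ _

end Dual

/-! ### Monomials in the increments span the principal parts. -/

section Span

variable {k R ι : Type*} [CommRing k] [CommRing R] [Algebra k R]

lemma evalDelta_X_mem (x : ι → R) (i : ι) : evalDelta k x (X i) ∈ ideal k R := by
  simp [evalDelta, RingHom.mem_ker]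

/-- The quotient `I/I²` is the module of differentials, and the class of the `i`-th increment is `D
(x i)`; these classes span. -/
lemma exists_sub_evalDelta_mem_sq [Finite ι] {x : ι → R} {d : ι → Derivation k R R}
    (h : IsCoordinates x d) {z : R ⊗[k] R} (hz : z ∈ ideal k R) :
    ∃ p : MvPolynomial ι R, p.totalDegree ≤ 1 ∧ evalDelta k x p ∈ ideal k R ∧
      z - evalDelta k x p ∈ ideal k R ^ 2 := by
  have := Fintype.ofFinite ι
  have hmem : fromIdeal k R ⟨z, hz⟩ ∈
      Submodule.span R (Set.range fun i => KaehlerDifferential.D k R (x i)) := by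
    rw [h.span_eq_top]; exact Submodule.mem_top
  obtain ⟨c, hc⟩ := (Submodule.mem_span_range_iff_exists_fun R).mp hmem
  have hI : evalDelta k x (∑ i, C (c i) * X i) ∈ ideal k R := by
    rw [map_sum]
    refine Ideal.sum_mem _ fun i _ => ?_
    rw [map_mul]
    exact Ideal.mul_mem_left _ _ (evalDelta_X_mem x i)
  refine ⟨∑ i, C (c i) * X i, ?_, hI, ?_⟩
  · refine totalDegree_finsetSum_le fun i _ => ?_
    rw [C_mul_X_eq_monomial]
    refine (totalDegree_monomial_le _ _).trans ?_
    simp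
  · have h1 : (⟨_, hI⟩ : ideal k R) = ∑ i, algebraMap R (R ⊗[k] R) (c i) •
        ⟨_, evalDelta_X_mem x i⟩ := by
      ext
      rw [AddSubmonoidClass.coe_finsetSum]
      change evalDelta k x _ = _
      rw [map_sum]
      refine Finset.sum_congr rfl fun i _ => ?_
      rw [map_mul, ← MvPolynomial.algebraMap_eq, AlgHom.commutes]
      rfl
    have h2 (i : ι) : fromIdeal k R ⟨_, evalDelta_X_mem x i⟩ = KaehlerDifferential.D k R (x i) := by
      rw [D_apply]
      refine congrArg (fromIdeal k R) (Subtype.ext ?_)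
      simp [evalDelta]
    have : fromIdeal k R ⟨z, hz⟩ = fromIdeal k R ⟨_, hI⟩ := by
      rw [h1, map_sum, ← hc]
      refine Finset.sum_congr rfl fun i _ => ?_
      rw [map_smul, h2, algebraMap_smul]
    exact (Ideal.toCotangent_eq _).mp this

/-- Linear approximations of elements of `I` modulo `I²` multiply to approximations of degree at
most `n` of elements of `I ^ n`. Successive corrections of this kind yield the Taylor expansion in
the next lemma. -/
lemma exists_sub_evalDelta_mem_pow_succ [Finite ι] {x : ι → R} {d : ι → Derivation k R R}
    (h : IsCoordinates x d) (n : ℕ) {z : R ⊗[k] R} (hz : z ∈ ideal k R ^ n) :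
    ∃ p : MvPolynomial ι R, p.totalDegree ≤ n ∧ z - evalDelta k x p ∈ ideal k R ^ (n + 1) := by
  induction n generalizing z with
  | zero =>
    -- In degree zero the approximation is the value on the diagonal.
    refine ⟨C (Algebra.TensorProduct.lmul' k z), by simp, ?_⟩
    rw [zero_add, pow_one, RingHom.mem_ker, map_sub]
    simp [evalDelta, Algebra.TensorProduct.algebraMap_apply]
  | succ n ih =>
    rw [pow_succ] at hz
    induction hz using Submodule.mul_induction_on' with
    | mem_mul_mem a ha b hb =>
      obtain ⟨p, hp, hpa⟩ := ih ha
      obtain ⟨q, hq, hqI, hqb⟩ := exists_sub_evalDelta_mem_sq h hb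
      refine ⟨p * q, (totalDegree_mul _ _).trans (add_le_add hp hq), ?_⟩
      have hpI : evalDelta k x p ∈ ideal k R ^ n := by
        have := Ideal.sub_mem _ ha (Ideal.pow_le_pow_right (Nat.le_succ n) hpa)
        rwa [sub_sub_cancel] at this
      have : a * b - evalDelta k x (p * q) =
          (a - evalDelta k x p) * b + evalDelta k x p * (b - evalDelta k x q) := by
        rw [map_mul]; ring
      rw [this]
      refine Ideal.add_mem _ ?_ ?_
      · rw [pow_succ]; exact Ideal.mul_mem_mul hpa hb
      · rw [show n + 1 + 1 = n + 2 from rfl, pow_add]; exact Ideal.mul_mem_mul hpI hqb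
    | add a _ b _ ha hb =>
      obtain ⟨p, hp, hpa⟩ := ha
      obtain ⟨q, hq, hqb⟩ := hb
      refine ⟨p + q, (totalDegree_add _ _).trans (max_le hp hq), ?_⟩
      rw [map_add, add_sub_add_comm]
      exact Ideal.add_mem _ hpa hqb

lemma exists_sub_evalDelta_mem [Finite ι] {x : ι → R} {d : ι → Derivation k R R}
    (h : IsCoordinates x d) (n : ℕ) (z : R ⊗[k] R) :
    ∃ p : MvPolynomial ι R, p.totalDegree ≤ n ∧ z - evalDelta k x p ∈ ideal k R ^ (n + 1) := by
  induction n with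
  | zero => exact exists_sub_evalDelta_mem_pow_succ h 0 (by simp)
  | succ n ih =>
    obtain ⟨p, hp, hz⟩ := ih
    obtain ⟨q, hq, hzq⟩ := exists_sub_evalDelta_mem_pow_succ h (n + 1) hz
    refine ⟨p + q, (totalDegree_add _ _).trans (max_le (hp.trans (Nat.le_succ n)) hq), ?_⟩
    rwa [map_add, ← sub_sub]

variable (k) in
/-- The class of the monomial of exponent `β` in the elements `1 ⊗ x i - x i ⊗ 1`. -/
def monomialDelta (n : ℕ) (x : ι → R) (β : ι →₀ ℕ) : PrincipalParts k R n :=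
  mk k R n (evalDelta k x (monomial β 1))

lemma exists_eq_sum_monomialDelta [Finite ι] {x : ι → R} {d : ι → Derivation k R R}
    (h : IsCoordinates x d) (n : ℕ) (a : PrincipalParts k R n) :
    ∃ p : MvPolynomial ι R, p.totalDegree ≤ n ∧
      a = ∑ β ∈ p.support, left k R n (coeff β p) * monomialDelta k n x β := by
  obtain ⟨z, rfl⟩ := mk_surjective k R n a
  obtain ⟨p, hp, hz⟩ := exists_sub_evalDelta_mem h n z
  refine ⟨p, hp, ?_⟩
  have h1 : mk k R n z = mk k R n (evalDelta k x p) := Ideal.Quotient.eq.mpr hz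
  rw [h1]
  conv_lhs => rw [p.as_sum, map_sum, map_sum]
  refine Finset.sum_congr rfl fun β _ => ?_
  rw [monomialDelta, left, RingHom.comp_apply, ← map_mul]
  congr 1
  rw [← mul_one (coeff β p), ← C_mul_monomial, map_mul, mul_one, ← MvPolynomial.algebraMap_eq,
    AlgHom.commutes]
  rfl

end Span

end PrincipalParts

/-! ### Divided differential operators as functionals on principal parts. -/

namespace PrincipalParts

variable {k R ι : Type*} [Field k] [CommRing R] [Algebra k R] (d : ι → Derivation k R R)
  {α : ι →₀ ℕ} {n : ℕ} (hα : α.degree ≤ n)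

/-- The functional on the principal parts of order `n` given by the differential operator
`(1 / α!) d ^ α`, for `|α| ≤ n`. -/
def dual : PrincipalParts k R n →+ R :=
  (mk k R n).toAddMonoidHom.liftOfSurjective (mk_surjective k R n)
    ⟨(dualOp d α).toAddMonoidHom, fun _ hz =>
      dualOp_of_mem d hα (Ideal.Quotient.eq_zero_iff_mem.mp hz)⟩

lemma dual_mk (z : R ⊗[k] R) : dual d hα (mk k R n z) = dualOp d α z :=
  AddMonoidHom.liftOfRightInverse_comp_apply _ _ _ _ z

lemma dual_left_mul (r : R) (a : PrincipalParts k R n) :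
    dual d hα (left k R n r * a) = r * dual d hα a := by
  obtain ⟨z, rfl⟩ := mk_surjective k R n a
  rw [left, RingHom.comp_apply, ← map_mul, dual_mk, dual_mk, ← smul_eq_mul r, ← map_smul]
  congr 1
  rw [Algebra.smul_def]
  rfl

end PrincipalParts

namespace PrincipalPartsModule

variable {k R ι : Type*} [Field k] [CommRing R] [Algebra k R] (d : ι → Derivation k R R)
  {α : ι →₀ ℕ} {n : ℕ} (hα : α.degree ≤ n) {M : Type*} [AddCommGroup M] [Module R M]
  (c : M →ₗ[R] R)

/-- The functional on the principal parts of order `n` of `M` given by the composition of a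
functional on `M` and the differential operator `(1 / α!) d ^ α`, for `|α| ≤ n`. -/
def dual : PrincipalPartsModule k R n M →ₗ[R] R where
  toFun z := PrincipalParts.dual d hα
    (TensorProduct.rid R (PrincipalParts k R n) (LinearMap.lTensor (PrincipalParts k R n) c z))
  map_add' z w := by
    rw [← map_add (PrincipalParts.dual d hα), ← map_add (TensorProduct.rid _ _)]
    congr 2
    exact map_add _ _ _
  map_smul' r z := by
    rw [RingHom.id_apply, smul_eq_mul, ← PrincipalParts.dual_left_mul]
    congr 1
    induction z using induction_on with
    | zero =>
      rw [smul_zero]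
      exact (map_zero ((TensorProduct.rid R _).toLinearMap.comp (LinearMap.lTensor _ c))).trans
        ((mul_zero _).symm.trans (congrArg _ (map_zero ((TensorProduct.rid R _).toLinearMap.comp
          (LinearMap.lTensor _ c))).symm))
    | tmul a m => exact (mul_smul_comm (c m) (PrincipalParts.left k R n r) a).symm
    | add z w hz hw =>
      rw [smul_add]
      refine (((congrArg (TensorProduct.rid R (PrincipalParts k R n)) (map_add _ _ _)).trans
        (map_add _ _ _)).trans (congrArg₂ (· + ·) hz hw)).trans ?_
      rw [← mul_add]
      congr 1
      rw [← map_add (TensorProduct.rid _ _)]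
      congr 1
      exact (map_add _ _ _).symm

lemma dual_tmul (a : PrincipalParts k R n) (m : M) :
    dual d hα c (tmul k n a m) =
      PrincipalParts.dual d hα (PrincipalParts.right k R n (c m) * a) := by
  change PrincipalParts.dual d hα (TensorProduct.rid R _ (_ ⊗ₜ[R] c m)) = _
  rw [TensorProduct.rid_tmul, Algebra.smul_def]
  rfl

section Map

variable {R' : Type*} [CommRing R'] [Algebra k R'] {d' : ι → Derivation k R' R'}
  {M' : Type*} [AddCommGroup M'] [Module R' M'] {c' : M' →ₗ[R'] R'} (σ : R →ₐ[k] R')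
  (g : M →ₛₗ[(σ : R →+* R')] M')

variable {d c}

/-- Applied to restriction maps, this compatibility lets the functionals over the various open sets
form a homomorphism of sheaves. The scalar `1/α!` comes from `k` and is preserved by `σ`. -/
lemma dual_map (hd : ∀ i a, σ (d i a) = d' i (σ a)) (hc : ∀ m, σ (c m) = c' (g m))
    (z : PrincipalPartsModule k R n M) : dual d' hα c' (map n σ g z) = σ (dual d hα c z) := by
  have hl (l : List ι) (a : R) : σ (PrincipalParts.derivationList d l a) =
      PrincipalParts.derivationList d' l (σ a) := by
    induction l with
    | nil => rfl
    | cons i l ih =>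
      simp only [PrincipalParts.derivationList, List.map_cons, List.prod_cons,
        Module.End.mul_apply] at *
      rw [← ih]
      exact hd _ _
  induction z using induction_on with
  | zero => simp
  | add z w hz hw => rw [map_add, map_add, hz, hw, map_add, map_add]
  | tmul a m =>
    rw [map_tmul, dual_tmul, dual_tmul, ← hc, ← PrincipalParts.map_right, ← map_mul]
    obtain ⟨z, hz⟩ := PrincipalParts.mk_surjective k R n (PrincipalParts.right k R n (c m) * a)
    rw [← hz, PrincipalParts.map_mk, PrincipalParts.dual_mk, PrincipalParts.dual_mk]
    clear hz
    induction z using TensorProduct.induction_on with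
    | zero => simp
    | add z w hz hw => simp only [map_add, hz, hw]
    | tmul a b =>
      rw [Algebra.TensorProduct.map_tmul, PrincipalParts.dualOp_tmul, PrincipalParts.dualOp_tmul,
        _root_.map_smul, map_mul, hl]

end Map

section Basis

variable {d} {x : ι → R}

lemma dual_monomialDelta_tmul [CharZero k] (h : IsCoordinates x d) (β : ι →₀ ℕ) {m : M}
    (hm : c m = 1) :
    dual d hα c (tmul k n (PrincipalParts.monomialDelta k n x β) m) = Finsupp.single β 1 α := by
  classical
  rw [dual_tmul, hm, map_one, one_mul, PrincipalParts.monomialDelta, PrincipalParts.dual_mk,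
    PrincipalParts.dualOp_evalDelta h, MvPolynomial.coeff_monomial, Finsupp.single_apply]

lemma dual_tmul_of_eq_zero (a : PrincipalParts k R n) {m : M} (hm : c m = 0) :
    dual d hα c (tmul k n a m) = 0 := by
  rw [dual_tmul, hm, map_zero, zero_mul, map_zero]

lemma mem_span_monomialDelta_tmul [Finite ι] (h : IsCoordinates x d) {κ : Type*} [Fintype κ]
    {e : κ → M} (he : Submodule.span R (Set.range e) = ⊤) (z : PrincipalPartsModule k R n M) :
    z ∈ Submodule.span R (Set.range fun i : {β : ι →₀ ℕ // β.degree ≤ n} × κ =>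
      tmul k n (PrincipalParts.monomialDelta k n x i.1.1) (e i.2)) := by
  induction z using induction_on with
  | zero => exact zero_mem _
  | add z w hz hw => exact add_mem hz hw
  | tmul a m =>
    obtain ⟨c, rfl⟩ := (Submodule.mem_span_range_iff_exists_fun R).mp
      (he ▸ Submodule.mem_top : m ∈ Submodule.span R (Set.range e))
    -- The coefficients of `m` cross the tensor sign as right multiplications; the resulting
    -- principal part is then expanded again with left coefficients.
    have h1 : tmul k n a (∑ j, c j • e j) =
        ∑ j, tmul k n (PrincipalParts.right k R n (c j) * a) (e j) :=
      (TensorProduct.tmul_sum a Finset.univ _).trans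
        (Finset.sum_congr rfl fun j _ => tmul_smul k n (c j) a (e j))
    rw [h1]
    refine sum_mem fun j _ => ?_
    obtain ⟨p, hp, hpa⟩ :=
      PrincipalParts.exists_eq_sum_monomialDelta h n (PrincipalParts.right k R n (c j) * a)
    have h2 : tmul k n (PrincipalParts.right k R n (c j) * a) (e j) = ∑ β ∈ p.support,
        p.coeff β • tmul k n (PrincipalParts.monomialDelta k n x β) (e j) := by
      rw [hpa]
      exact TensorProduct.sum_tmul _ _ _
    rw [h2]
    refine sum_mem fun β hβ => Submodule.smul_mem _ _ (Submodule.subset_span ⟨⟨⟨β, ?_⟩, j⟩, rfl⟩)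
    exact (MvPolynomial.le_totalDegree hβ).trans hp

end Basis

end PrincipalPartsModule

namespace AlgebraicGeometry.Scheme

/-! ### Coordinates on schemes -/

section Coordinates

variable (k : Type u) [CommRing k] {X : Scheme.{u}} [X.Over (Spec (.of k))]

lemma finiteType_of_isAffineOpen [LocallyOfFiniteType (X ↘ Spec (.of k))] {U : X.Opens}
    (hU : IsAffineOpen U) : Algebra.FiniteType k Γ(X, U) := by
  have h1 := (X ↘ Spec (.of k)).finiteType_appLE (isAffineOpen_top _) hU le_top
  have h2 : (scalars k X U).FiniteType :=
    h1.comp (RingHom.FiniteType.of_surjective (Scheme.ΓSpecIso (.of k)).inv.hom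
      (Scheme.ΓSpecIso (.of k)).symm.commRingCatIsoToRingEquiv.surjective)
  exact h2

/-- Germs of functions, as a homomorphism of `k`-algebras. -/
def germAlgHom (U : X.Opens) (x : X) (hx : x ∈ U) : Γ(X, U) →ₐ[k] X.presheaf.stalk x where
  __ := (X.presheaf.germ U x hx).hom
  commutes' c := germ_algebraMap k x U hx c

lemma germAlgHom_resAlgHom {U V : X.Opens} (i : V ⟶ U) (x : X) (hx : x ∈ V) (a : Γ(X, U)) :
    germAlgHom k V x hx (resAlgHom k i a) = germAlgHom k U x (i.le hx) a :=
  TopCat.Presheaf.germ_res_apply X.presheaf i x hx a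

lemma eq_of_germAlgHom_eq {U : X.Opens} {a b : Γ(X, U)}
    (h : ∀ x hx, germAlgHom k U x hx a = germAlgHom k U x hx b) : a = b :=
  TopCat.Presheaf.section_ext X.sheaf U a b h

lemma exists_section_of_forall_germ {U : X.Opens} (t : ∀ x ∈ U, X.presheaf.stalk x)
    (h : ∀ x ∈ U, ∃ V ≤ U, x ∈ V ∧ ∃ s : Γ(X, V), ∀ (y) (hyV : y ∈ V) (hyU : y ∈ U),
      germAlgHom k V y hyV s = t y hyU) :
    ∃ s : Γ(X, U), ∀ (x) (hx : x ∈ U), germAlgHom k U x hx s = t x hx := by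
  choose V hVU hxV s hs using h
  obtain ⟨a, ha, -⟩ := X.sheaf.existsUnique_gluing' (fun x : U => V x.1 x.2) U
    (fun x => homOfLE (hVU x.1 x.2)) (fun x hx => TopologicalSpace.Opens.mem_iSup.mpr
      ⟨⟨x, hx⟩, hxV x hx⟩) (fun x => s x.1 x.2) (by
      intro x y
      refine TopCat.Presheaf.section_ext X.sheaf _ _ _ fun z hz => ?_
      refine (TopCat.Presheaf.germ_res_apply _ _ _ _ _).trans
        (Eq.trans ?_ (TopCat.Presheaf.germ_res_apply _ _ _ _ _).symm)
      exact (hs x.1 x.2 z hz.1 (hVU _ _ hz.1)).trans (hs y.1 y.2 z hz.2 (hVU _ _ hz.1)).symm)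
  refine ⟨a, fun x hx => ?_⟩
  rw [← hs x hx x (hxV x hx) hx, ← ha ⟨x, hx⟩]
  exact (TopCat.Presheaf.germ_res_apply X.presheaf (homOfLE (hVU x hx)) x (hxV x hx) a).symm

variable {ι : Type*} {U : X.Opens} {x : ι → Γ(X, U)}
  {d : ι → Derivation k Γ(X, U) Γ(X, U)}

lemma exists_isCoordinates_stalk (hU : IsAffineOpen U) (h : IsCoordinates x d) (y : X) (hy : y ∈ U) :
    ∃ d' : ι → Derivation k (X.presheaf.stalk y) (X.presheaf.stalk y),
      IsCoordinates (fun i => germAlgHom k U y hy (x i)) d' := by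
  let := X.presheaf.algebra_section_stalk (⟨y, hy⟩ : U)
  have := hU.isLocalization_stalk ⟨y, hy⟩
  have : Algebra.FormallyEtale Γ(X, U) (X.presheaf.stalk y) :=
    .of_isLocalization (hU.primeIdealOf ⟨y, hy⟩).asIdeal.primeCompl
  have : IsScalarTower k Γ(X, U) (X.presheaf.stalk y) :=
    .of_algebraMap_eq fun c => ((germAlgHom k U y hy).commutes c).symm
  exact h.exists_of_formallyEtale

lemma exists_isCoordinates_basicOpen (hU : IsAffineOpen U) (h : IsCoordinates x d) (f : Γ(X, U)) :
    ∃ d' : ι → Derivation k Γ(X, X.basicOpen f) Γ(X, X.basicOpen f),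
      IsCoordinates (fun i => resAlgHom k (homOfLE (X.basicOpen_le f)) (x i)) d' := by
  have := hU.isLocalization_basicOpen f
  have : Algebra.FormallyEtale Γ(X, U) Γ(X, X.basicOpen f) :=
    .of_isLocalization (Submonoid.powers f)
  have : IsScalarTower k Γ(X, U) Γ(X, X.basicOpen f) :=
    .of_algebraMap_eq fun c => ((resAlgHom k (homOfLE (X.basicOpen_le f))).commutes c).symm
  exact h.exists_of_formallyEtale

/-- Partial derivations with respect to coordinates on an affine open subset extend to all smaller
open subsets. -/
lemma exists_derivation (hU : IsAffineOpen U) (h : IsCoordinates x d) :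
    ∃ d' : ∀ W ≤ U, ι → Derivation k Γ(X, W) Γ(X, W),
      (∀ (V W : X.Opens) (hV : V ≤ U) (hW : W ≤ U) (i : V ⟶ W) (j : ι) (a : Γ(X, W)),
        resAlgHom k i (d' W hW j a) = d' V hV j (resAlgHom k i a)) ∧
      ∀ y ∈ U, ∀ V : X.Opens, y ∈ V → ∃ (W : X.Opens) (hWU : W ≤ U), W ≤ V ∧ y ∈ W ∧
        IsCoordinates (fun j => resAlgHom k (homOfLE hWU) (x j)) (d' W hWU) := by
  choose ds hds using fun (y : X) (hy : y ∈ U) => exists_isCoordinates_stalk k hU h y hy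
  choose db hdb using exists_isCoordinates_basicOpen k hU h
  -- Partial derivations are determined by the coordinates, so those on basic opens and on stalks
  -- agree automatically.
  have hgerm (f : Γ(X, U)) (y : X) (hy : y ∈ X.basicOpen f) (j : ι) (a : Γ(X, X.basicOpen f)) :
      germAlgHom k _ y hy (db f j a) =
        ds y (X.basicOpen_le f hy) j (germAlgHom k _ y hy a) :=
    (hdb f).map_apply (hds y (X.basicOpen_le f hy)) (germAlgHom k _ y hy)
      (fun i => germAlgHom_resAlgHom k (homOfLE (X.basicOpen_le f)) y hy (x i)) j a
  -- For a general `W` the sections need not be a localization of those over `U`; the derivative is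
  -- prescribed on germs and glued from basic opens.
  have hex (W : X.Opens) (hW : W ≤ U) (j : ι) (a : Γ(X, W)) : ∃ b : Γ(X, W), ∀ (y) (hy : y ∈ W),
      germAlgHom k W y hy b = ds y (hW hy) j (germAlgHom k W y hy a) := by
    refine exists_section_of_forall_germ k (fun y hy => ds y (hW hy) j (germAlgHom k W y hy a)) ?_
    intro y hy
    obtain ⟨f, hf, hyf⟩ := hU.exists_basicOpen_le ⟨y, hy⟩ (hW hy)
    refine ⟨X.basicOpen f, hf, hyf, db f j (resAlgHom k (homOfLE hf) a), fun z hz hzW => ?_⟩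
    rw [hgerm, germAlgHom_resAlgHom]
  choose D hD using hex
  let d' (W : X.Opens) (hW : W ≤ U) (j : ι) : Derivation k Γ(X, W) Γ(X, W) :=
    Derivation.mk'
      { toFun := D W hW j
        map_add' a b := eq_of_germAlgHom_eq k fun y hy => by simp only [hD, map_add]
        map_smul' c a := eq_of_germAlgHom_eq k fun y hy => by
          simp only [hD, map_smul, Derivation.map_smul, RingHom.id_apply] }
      fun a b => eq_of_germAlgHom_eq k fun y hy => by
        simp only [LinearMap.coe_mk, AddHom.coe_mk, smul_eq_mul, hD, map_add, map_mul,
          Derivation.leibniz]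
  have hd' (W : X.Opens) (hW : W ≤ U) (j : ι) (a : Γ(X, W)) (y : X) (hy : y ∈ W) :
      germAlgHom k W y hy (d' W hW j a) = ds y (hW hy) j (germAlgHom k W y hy a) := hD W hW j a y hy
  refine ⟨d', fun V W hV hW i j a => eq_of_germAlgHom_eq k fun y hy => ?_, fun y hy V hyV => ?_⟩
  · rw [germAlgHom_resAlgHom, hd', hd', germAlgHom_resAlgHom]
  · obtain ⟨f, hf, hyf⟩ := hU.exists_basicOpen_le ⟨y, hyV⟩ hy
    refine ⟨X.basicOpen f, X.basicOpen_le f, hf, hyf, ?_⟩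
    have : d' (X.basicOpen f) (X.basicOpen_le f) = db f := by
      funext j
      ext a
      exact eq_of_germAlgHom_eq k fun y hy => (hd' _ _ _ _ _ _).trans (hgerm f y hy j a).symm
    rw [this]
    exact hdb f

end Coordinates

/-- Coordinates exist in a neighbourhood of a regular point of a scheme that is locally of finite
type over a field of characteristic zero. -/
lemma exists_isAffineOpen_isCoordinates (k : Type u) [Field k] [CharZero k] {X : Scheme.{u}}
    [X.Over (Spec (.of k))] [LocallyOfFiniteType (X ↘ Spec (.of k))] {y : X}
    (hy : IsRegularLocalRing (X.presheaf.stalk y)) {V : X.Opens} (hyV : y ∈ V) :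
    ∃ U : X.Opens, IsAffineOpen U ∧ y ∈ U ∧ U ≤ V ∧ ∃ (ι : Type) (_ : Finite ι)
      (x : ι → Γ(X, U)) (d : ι → Derivation k Γ(X, U) Γ(X, U)), IsCoordinates x d := by
  obtain ⟨W, hW, hyW, hWV⟩ := exists_isAffineOpen_mem_and_subset hyV
  have := finiteType_of_isAffineOpen k hW
  let p := (hW.primeIdealOf ⟨y, hyW⟩).asIdeal
  let := X.presheaf.algebra_section_stalk (⟨y, hyW⟩ : W)
  have := hW.isLocalization_stalk ⟨y, hyW⟩
  have : IsRegularLocalRing (Localization.AtPrime p) := .of_ringEquiv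
    (IsLocalization.algEquiv p.primeCompl (X.presheaf.stalk y) (Localization.AtPrime p)).toRingEquiv
  obtain ⟨f, hf, hsm⟩ := Algebra.exists_isStandardSmooth_of_isRegularLocalRing (k := k) p
  have hloc := hW.isLocalization_basicOpen f
  have : IsScalarTower k Γ(X, W) Γ(X, X.basicOpen f) :=
    .of_algebraMap_eq fun c => ((resAlgHom k (homOfLE (X.basicOpen_le f))).commutes c).symm
  have : Algebra.IsStandardSmooth k Γ(X, X.basicOpen f) := .of_algEquiv
    ((IsLocalization.algEquiv (Submonoid.powers f) (Localization.Away f)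
      Γ(X, X.basicOpen f)).restrictScalars k)
  have hyf : y ∈ X.basicOpen f := by
    rw [Scheme.mem_basicOpen _ _ _ hyW]
    exact IsLocalization.map_units (X.presheaf.stalk y) (⟨f, hf⟩ : p.primeCompl)
  obtain ⟨-, ι, b, hb⟩ :=
    Algebra.IsStandardSmooth.iff_exists_basis_kaehlerDifferential.mp this
  have := nontrivial_of_ne _ _ (one_ne_zero : (1 : X.presheaf.stalk y) ≠ 0)
  -- Over the zero ring a basis of a finite module could be infinite.
  have : Nontrivial Γ(X, X.basicOpen f) := (germAlgHom k _ y hyf).toRingHom.domain_nontrivial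
  choose x hx using fun i => hb ⟨i, rfl⟩
  exact ⟨X.basicOpen f, hW.basicOpen f, hyf, (X.basicOpen_le f).trans hWV, ι,
    Module.Finite.finite_basis b, x, _, .of_basis b fun i => (hx i).symm⟩

end AlgebraicGeometry.Scheme

/-! ### Local coordinates of locally free modules -/

/-- A finite coproduct in a preadditive category is a biproduct; the projections come from the
universal property of the coproduct. -/
lemma CategoryTheory.Limits.Cofan.exists_biproduct_data {C : Type*} [Category C] [Preadditive C]
    {I : Type*} [Fintype I] [DecidableEq I] {A N : C} {c : Limits.Cofan fun _ : I => A}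
    (hc : Limits.IsColimit c) (φ : N ≅ c.pt) :
    ∃ (a : I → (A ⟶ N)) (b : I → (N ⟶ A)),
      (∀ p q, a p ≫ b q = if p = q then 𝟙 A else 0) ∧ ∑ p, b p ≫ a p = 𝟙 N := by
  let π (q : I) : c.pt ⟶ A :=
    Limits.Cofan.IsColimit.desc hc fun p => if p = q then 𝟙 A else 0
  have hπ (p q : I) : c.inj p ≫ π q = if p = q then 𝟙 A else 0 :=
    Limits.Cofan.IsColimit.fac hc _ p
  refine ⟨fun p => c.inj p ≫ φ.inv, fun q => φ.hom ≫ π q, fun p q => by simp [hπ], ?_⟩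
  have h1 : ∑ p, π p ≫ c.inj p = 𝟙 c.pt := by
    refine Limits.Cofan.IsColimit.hom_ext hc _ _ fun q => ?_
    rw [Preadditive.comp_sum]
    simp only [← Category.assoc, hπ]
    simp [ite_comp, Finset.sum_ite_eq]
  calc ∑ p, (φ.hom ≫ π p) ≫ c.inj p ≫ φ.inv
      = φ.hom ≫ (∑ p, π p ≫ c.inj p) ≫ φ.inv := by
        simp only [Preadditive.sum_comp, Preadditive.comp_sum, Category.assoc]
    _ = 𝟙 N := by simp [h1]

namespace AlgebraicGeometry.Scheme.Modules

/-- The inclusions of the summands, evaluated at the section `1`, give the basis, and the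
projections to the structure sheaf give the coordinates, compatible with restriction because they
are sheaf morphisms. -/
lemma exists_dual_of_iso_free {Y : Scheme.{u}} {N : Y.Modules} {r : ℕ}
    (φ : N ≅ SheafOfModules.free (R := Y.ringCatSheaf) (ULift.{u} (Fin r))) :
    ∃ (e : Fin r → Γ(N, ⊤)) (c : ∀ W : Y.Opens, Fin r → Γ(N, W) →ₗ[Γ(Y, W)] Γ(Y, W)),
      (∀ (V W : Y.Opens) (i : V ⟶ W) (p : Fin r) (m : Γ(N, W)),
        Y.presheaf.map i.op (c W p m) = c V p (N.presheaf.map i.op m)) ∧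
      (∀ p q, c ⊤ p (e q) = if p = q then 1 else 0) ∧
      ∀ (W : Y.Opens) (m : Γ(N, W)),
        m = ∑ p, c W p m • N.presheaf.map (homOfLE (le_top : W ≤ ⊤)).op (e p) := by
  let A : Y.Modules := SheafOfModules.unit Y.ringCatSheaf
  let cf : Limits.Cofan fun _ : ULift.{u} (Fin r) => A :=
    SheafOfModules.freeCofan (R := Y.ringCatSheaf) (ULift.{u} (Fin r))
  have hcf : Limits.IsColimit cf :=
    SheafOfModules.isColimitFreeCofan (R := Y.ringCatSheaf) (ULift.{u} (Fin r))
  obtain ⟨a, b, hab, hba⟩ := Limits.Cofan.exists_biproduct_data hcf φ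
  let one (W : Y.Opens) : Γ(A, W) := (1 : Γ(Y, W))
  let c (W : Y.Opens) (p : Fin r) : Γ(N, W) →ₗ[Γ(Y, W)] Γ(Y, W) :=
    { toFun m := (b ⟨p⟩).app W m
      map_add' m m' := map_add ((b ⟨p⟩).app W).hom m m'
      map_smul' t m := (b ⟨p⟩).app_smul t m }
  refine ⟨fun p => (a ⟨p⟩).app ⊤ (one ⊤), c, fun V W i p m => ?_, fun p q => ?_, fun W m => ?_⟩
  · exact (ConcreteCategory.congr_hom ((b ⟨p⟩).mapPresheaf.naturality i.op) m).symm
  · have h1 : c ⊤ p ((a ⟨q⟩).app ⊤ (one ⊤)) = (a ⟨q⟩ ≫ b ⟨p⟩).app ⊤ (one ⊤) := rfl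
    rw [h1, hab]
    by_cases hpq : p = q
    · subst hpq
      rw [if_pos rfl, if_pos rfl]
      rfl
    · rw [if_neg hpq, if_neg fun h => hpq (congrArg ULift.down h).symm]
      rfl
  · let ev : (N ⟶ N) →+ Γ(N, W) :=
      { toFun f := f.app W m
        map_zero' := rfl
        map_add' _ _ := rfl }
    have h1 : m = ∑ p, ev (b p ≫ a p) := by
      rw [← map_sum, hba]
      rfl
    have h2 (p : Fin r) : (a ⟨p⟩).app W (one W) =
        N.presheaf.map (homOfLE (le_top : W ≤ ⊤)).op ((a ⟨p⟩).app ⊤ (one ⊤)) := by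
      refine Eq.trans ?_ (ConcreteCategory.congr_hom
        ((a ⟨p⟩).mapPresheaf.naturality (homOfLE (le_top : W ≤ ⊤)).op) (one ⊤))
      exact congrArg ((a ⟨p⟩).app W)
        (map_one (Y.presheaf.map (homOfLE (le_top : W ≤ ⊤)).op).hom).symm
    refine h1.trans ?_
    rw [← Equiv.sum_comp Equiv.ulift.symm]
    refine Finset.sum_congr rfl fun p _ => ?_
    rw [← h2]
    refine Eq.trans ?_ ((a ⟨p⟩).app_smul (c W p m) (one W))
    exact congrArg ((a ⟨p⟩).app W) (mul_one (c W p m)).symm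

lemma presheaf_map_map {X : Scheme.{u}} (M : X.Modules) {U V W : X.Opens} (i : V ⟶ U) (j : W ⟶ V)
    (l : W ⟶ U) (m : Γ(M, U)) :
    M.presheaf.map j.op (M.presheaf.map i.op m) = M.presheaf.map l.op m := by
  rw [Subsingleton.elim l (j ≫ i), op_comp, M.presheaf.map_comp]
  rfl

lemma presheaf_map_self {X : Scheme.{u}} (M : X.Modules) {U : X.Opens} (i : U ⟶ U) (m : Γ(M, U)) :
    M.presheaf.map i.op m = m := by
  rw [Subsingleton.elim i (𝟙 U), op_id, M.presheaf.map_id]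
  rfl

lemma _root_.AlgebraicGeometry.Scheme.presheaf_map_map {X : Scheme.{u}} {U V W : X.Opens}
    (i : V ⟶ U) (j : W ⟶ V) (l : W ⟶ U) (a : Γ(X, U)) :
    X.presheaf.map j.op (X.presheaf.map i.op a) = X.presheaf.map l.op a := by
  rw [Subsingleton.elim l (j ≫ i), op_comp, X.presheaf.map_comp]
  rfl

lemma _root_.AlgebraicGeometry.Scheme.presheaf_map_self {X : Scheme.{u}} {U : X.Opens} (i : U ⟶ U)
    (a : Γ(X, U)) : X.presheaf.map i.op a = a := by
  rw [Subsingleton.elim i (𝟙 U), op_id, X.presheaf.map_id]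
  rfl

/-- Sections of the restriction of `M` to `U` over the preimage of `W ≤ U` are sections of `M` over
`W`. -/
lemma exists_restrict_comparison {X : Scheme.{u}} (M : X.Modules) (U : X.Opens) :
    ∃ (ρ : ∀ W ≤ U, Γ(U, U.ι ⁻¹ᵁ W) →+* Γ(X, W))
      (τ : ∀ W : X.Opens, Γ(M, W) →+ Γ(M.restrict U.ι, U.ι ⁻¹ᵁ W))
      (τ' : ∀ W ≤ U, Γ(M.restrict U.ι, U.ι ⁻¹ᵁ W) →+ Γ(M, W)),
      (∀ W hW, Function.Surjective (ρ W hW)) ∧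
      (∀ W hW m, τ' W hW (τ W m) = m) ∧ (∀ W hW m, τ W (τ' W hW m) = m) ∧
      (∀ W hW t m, τ' W hW (t • m) = ρ W hW t • τ' W hW m) ∧
      (∀ V W hV hW (i : V ⟶ W) t, X.presheaf.map i.op (ρ W hW t) =
        ρ V hV (U.toScheme.presheaf.map (homOfLE (U.ι.preimage_mono i.le)).op t)) ∧
      ∀ V W (i : V ⟶ W) m, τ V (M.presheaf.map i.op m) =
        (M.restrict U.ι).presheaf.map (homOfLE (U.ι.preimage_mono i.le)).op (τ W m) := by
  -- The two open sets are equal only propositionally, so sections are transported by restriction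
  -- along both inclusions.
  have hle (W : X.Opens) (hW : W ≤ U) : W ≤ U.ι ''ᵁ U.ι ⁻¹ᵁ W := by
    rw [U.ι.image_preimage_eq_opensRange_inf]
    simp [hW]
  have hge (W : X.Opens) : U.ι ''ᵁ U.ι ⁻¹ᵁ W ≤ W := U.ι.image_preimage_le W
  refine ⟨fun W hW => (X.presheaf.map (homOfLE (hle W hW)).op).hom.comp
      (U.ι.appIso (U.ι ⁻¹ᵁ W)).inv.hom,
    fun W => (M.presheaf.map (homOfLE (hge W)).op).hom,
    fun W hW => (M.presheaf.map (homOfLE (hle W hW)).op).hom,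
    fun W hW t => ?_, fun W hW m => ?_, fun W hW m => ?_, fun W hW t m => ?_,
    fun V W hV hW i t => ?_, fun V W i m => ?_⟩
  · refine ⟨(U.ι.appIso (U.ι ⁻¹ᵁ W)).hom (X.presheaf.map (homOfLE (hge W)).op t), ?_⟩
    change X.presheaf.map (homOfLE (hle W hW)).op ((U.ι.appIso (U.ι ⁻¹ᵁ W)).inv
      ((U.ι.appIso (U.ι ⁻¹ᵁ W)).hom _)) = t
    rw [Iso.hom_inv_id_apply]
    exact (AlgebraicGeometry.Scheme.presheaf_map_map _ _ (𝟙 W) t).trans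
      (AlgebraicGeometry.Scheme.presheaf_map_self _ t)
  · exact (presheaf_map_map M _ _ (𝟙 W) m).trans (presheaf_map_self M _ m)
  · exact (presheaf_map_map M _ _ (𝟙 _) m).trans (presheaf_map_self M _ m)
  · exact M.map_smul (homOfLE (hle W hW)) ((U.ι.appIso (U.ι ⁻¹ᵁ W)).inv t) m
  · refine (AlgebraicGeometry.Scheme.presheaf_map_map _ _
      (homOfLE (i.le.trans (hle W hW))) _).trans ?_
    refine Eq.trans ?_ (congrArg (X.presheaf.map (homOfLE (hle V hV)).op)
      (ConcreteCategory.congr_hom (U.ι.appIso_inv_naturality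
        (homOfLE (U.ι.preimage_mono i.le)).op) t).symm)
    exact (AlgebraicGeometry.Scheme.presheaf_map_map _ _ _ _).symm
  · exact (presheaf_map_map M i (homOfLE (hge V)) (homOfLE ((hge V).trans i.le)) m).trans
      (presheaf_map_map M (homOfLE (hge W))
        (U.ι.opensFunctor.map (homOfLE (U.ι.preimage_mono i.le))) _ m).symm

/-- A locally free module of finite rank has a finite basis of sections in a neighbourhood of every
point. -/
lemma IsLocallyFreeOfFiniteRank.exists_dual {X : Scheme.{u}} {M : X.Modules}
    (hM : M.IsLocallyFreeOfFiniteRank) (x : X) :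
    ∃ (U : X.Opens) (_ : x ∈ U) (r : ℕ) (e : Fin r → Γ(M, U))
      (c : ∀ W ≤ U, Fin r → Γ(M, W) →ₗ[Γ(X, W)] Γ(X, W)),
      (∀ (V W : X.Opens) (hV : V ≤ U) (hW : W ≤ U) (i : V ⟶ W) (p : Fin r) (m : Γ(M, W)),
        X.presheaf.map i.op (c W hW p m) = c V hV p (M.presheaf.map i.op m)) ∧
      (∀ p q, c U le_rfl p (e q) = if p = q then 1 else 0) ∧
      ∀ (W : X.Opens) (hW : W ≤ U) (m : Γ(M, W)),
        m = ∑ p, c W hW p m • M.presheaf.map (homOfLE hW).op (e p) := by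
  obtain ⟨U, hxU, r, ⟨φ⟩⟩ := hM x
  obtain ⟨e, c, h1, h2, h3⟩ := exists_dual_of_iso_free φ
  obtain ⟨ρ, τ, τ', hρ, hττ', hτ'τ, hτ', hρnat, hτnat⟩ := exists_restrict_comparison M U
  have hτ (W : X.Opens) (hW : W ≤ U) (t) (m) : τ W (ρ W hW t • m) = t • τ W m := by
    rw [← hτ'τ W hW (t • τ W m), hτ' W hW, hττ' W hW]
  have he (W : X.Opens) (hW : W ≤ U) (p : Fin r) :
      M.presheaf.map (homOfLE hW).op (τ' U le_rfl
        ((M.restrict U.ι).presheaf.map (homOfLE le_top).op (e p))) =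
        τ' W hW ((M.restrict U.ι).presheaf.map (homOfLE le_top).op (e p)) := by
    rw [← hττ' W hW (M.presheaf.map _ _), hτnat, hτ'τ]
    exact congrArg (τ' W hW) (presheaf_map_map _ _ _ _ _)
  refine ⟨U, hxU, r, fun p => τ' U le_rfl
      ((M.restrict U.ι).presheaf.map (homOfLE le_top).op (e p)), fun W hW p =>
    { toFun m := ρ W hW (c _ p (τ W m))
      map_add' m m' := by rw [map_add, map_add, map_add]
      map_smul' t m := by
        obtain ⟨t, rfl⟩ := hρ W hW t
        rw [hτ, _root_.map_smul, smul_eq_mul, map_mul]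
        rfl }, fun V W hV hW i p m => ?_, fun p q => ?_, fun W hW m => ?_⟩
  · refine (hρnat V W hV hW i _).trans (congrArg (ρ V hV) ?_)
    exact (h1 _ _ _ p _).trans (congrArg _ (hτnat V W i m).symm)
  · change ρ U le_rfl (c _ p (τ U (τ' U le_rfl _))) = _
    rw [hτ'τ U le_rfl, ← h1 _ _ (homOfLE le_top), h2]
    split_ifs <;> simp
  · refine (hττ' W hW m).symm.trans ?_
    rw [h3 _ (τ W m), map_sum]
    refine Finset.sum_congr rfl fun p _ => ?_
    rw [hτ']
    exact congrArg _ (he W hW p).symm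

end AlgebraicGeometry.Scheme.Modules

namespace AlgebraicGeometry.Scheme.Modules

variable {X : Scheme.{u}} (k : Type u) [CommRing k] [X.Over (Spec (.of k))] (M : X.Modules) (n : ℕ)

/-! ### Homomorphisms out of the sheaf of principal parts -/

lemma exists_toPrincipalParts_eq {U : X.Opens} (s : Γ(principalParts k M n, U)) (x : X)
    (hx : x ∈ U) : ∃ (V : X.Opens) (i : V ⟶ U) (_ : x ∈ V) (z : principalPartsObj k M n V),
      toPrincipalParts k M n V z = (principalParts k M n).presheaf.map i.op s := by
  have h := Presheaf.imageSieve_mem (J := Opens.grothendieckTopology X)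
    (toSheafify (Opens.grothendieckTopology X) (principalPartsPresheaf k M n).presheaf) s
  obtain ⟨V, i, ⟨z, hz⟩, hxV⟩ := h x hx
  exact ⟨V, i, hxV, z, hz⟩

lemma exists_germ_toPrincipalParts_eq {x : X} {U : X.Opens} (hx : x ∈ U)
    (s : (principalParts k M n).presheaf.stalk x) :
    ∃ (V : X.Opens) (_ : V ≤ U) (hxV : x ∈ V) (z : principalPartsObj k M n V),
      (principalParts k M n).presheaf.germ V x hxV (toPrincipalParts k M n V z) = s := by
  obtain ⟨W, hW, hxW, s, rfl⟩ := (principalParts k M n).presheaf.exists_le_germ_eq s hx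
  obtain ⟨V, i, hxV, z, hz⟩ := exists_toPrincipalParts_eq k M n s x hxW
  refine ⟨V, i.le.trans hW, hxV, z, ?_⟩
  rw [hz]
  exact TopCat.Presheaf.germ_res_apply _ _ _ _ _

lemma eq_of_forall_exists_map_eq {N : X.Modules} {U : X.Opens} {s t : Γ(N, U)}
    (h : ∀ x ∈ U, ∃ (V : X.Opens) (i : V ⟶ U) (_ : x ∈ V),
      N.presheaf.map i.op s = N.presheaf.map i.op t) : s = t := by
  refine TopCat.Presheaf.section_ext ⟨N.presheaf, N.isSheaf⟩ U s t fun x hx => ?_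
  obtain ⟨V, i, hxV, h⟩ := h x hx
  have h' := congrArg (N.presheaf.germ V x hxV) h
  exact (TopCat.Presheaf.germ_res_apply N.presheaf i x hxV s).symm.trans
    (h'.trans (TopCat.Presheaf.germ_res_apply N.presheaf i x hxV t))

variable {k M n}

/-- The maps `ψ` exist only over opens inside `U`, while sheafification is universal for maps on all
of `X`. Replacing `N` by the pushforward of its restriction to `U`, whose sections over `W` are
those of `N` over `W ∩ U`, makes `ψ` a global map of presheaves. -/
lemma exists_addHom_of_forall {N : X.Modules} {U : X.Opens}
    (ψ : ∀ W ≤ U, principalPartsObj k M n W →+ Γ(N, W))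
    (hψ : ∀ (W W' : X.Opens) (hW : W ≤ U) (hW' : W' ≤ U) (i : W' ⟶ W)
      (z : principalPartsObj k M n W),
      ψ W' hW' (principalPartsRes k M n i z) = N.presheaf.map i.op (ψ W hW z)) :
    ∃ φ : ∀ W ≤ U, Γ(principalParts k M n, W) →+ Γ(N, W),
      (∀ (W W' : X.Opens) (hW : W ≤ U) (hW' : W' ≤ U) (i : W' ⟶ W) (s : Γ(principalParts k M n, W)),
        φ W' hW' ((principalParts k M n).presheaf.map i.op s) = N.presheaf.map i.op (φ W hW s)) ∧
      ∀ (W : X.Opens) (hW : W ≤ U) (z : principalPartsObj k M n W),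
        φ W hW (toPrincipalParts k M n W z) = ψ W hW z := by
  have hle (W : X.Opens) (hW : W ≤ U) : W ≤ U.ι ''ᵁ U.ι ⁻¹ᵁ W := by
    rw [U.ι.image_preimage_eq_opensRange_inf]
    simp [hW]
  have hge (W : X.Opens) : U.ι ''ᵁ U.ι ⁻¹ᵁ W ≤ W := U.ι.image_preimage_le W
  have hU (W : X.Opens) : U.ι ''ᵁ U.ι ⁻¹ᵁ W ≤ U := by
    rw [U.ι.image_preimage_eq_opensRange_inf]
    simp
  let F : X.Modules := (pushforward U.ι).obj (N.restrict U.ι)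
  let η : (principalPartsPresheaf k M n).presheaf ⟶ F.presheaf :=
    { app W := AddCommGrpCat.ofHom ((ψ _ (hU W.unop)).comp
        (principalPartsRes k M n (homOfLE (hge W.unop))).toAddMonoidHom)
      naturality W W' i := by
        ext z
        refine Eq.trans ?_ (hψ _ _ (hU W.unop) (hU W'.unop)
          (U.ι.opensFunctor.map ((TopologicalSpace.Opens.map U.ι.base).map i.unop)) _)
        refine congrArg (ψ _ (hU W'.unop)) ?_
        exact (principalPartsRes_comp k M n i.unop (homOfLE (hge W'.unop)) z).symm.trans
          (principalPartsRes_comp k M n (homOfLE (hge W.unop)) (U.ι.opensFunctor.map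
            ((TopologicalSpace.Opens.map U.ι.base).map i.unop)) z) }
  let θ : (principalParts k M n).presheaf ⟶ F.presheaf :=
    sheafifyLift (Opens.grothendieckTopology X) η F.isSheaf
  have hθ (W : X.Opens) (z : principalPartsObj k M n W) :
      θ.app (op W) (toPrincipalParts k M n W z) = η.app (op W) z :=
    ConcreteCategory.congr_hom (NatTrans.congr_app
      (toSheafify_sheafifyLift (Opens.grothendieckTopology X) η F.isSheaf) (op W)) z
  refine ⟨fun W hW => (N.presheaf.map (homOfLE (hle W hW)).op).hom.comp (θ.app (op W)).hom,
    fun W W' hW hW' i s => ?_, fun W hW z => ?_⟩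
  · have h := ConcreteCategory.congr_hom (θ.naturality i.op) s
    refine (congrArg (N.presheaf.map (homOfLE (hle W' hW')).op) h).trans ?_
    refine (presheaf_map_map N (U.ι.opensFunctor.map ((TopologicalSpace.Opens.map U.ι.base).map i))
      (homOfLE (hle W' hW')) (homOfLE (i.le.trans (hle W hW))) _).trans ?_
    exact (presheaf_map_map N (homOfLE (hle W hW)) i _ _).symm
  · refine (congrArg (N.presheaf.map (homOfLE (hle W hW)).op) (hθ W z)).trans ?_
    refine (hψ _ _ (hU W) hW (homOfLE (hle W hW)) _).symm.trans ?_
    refine congrArg (ψ W hW) ?_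
    exact (principalPartsRes_comp k M n _ _ z).symm.trans (principalPartsRes_id k M n W z)

lemma exists_homOn_of_forall {N : X.Modules} {U : X.Opens}
    (ψ : ∀ W ≤ U, principalPartsObj k M n W →ₗ[Γ(X, W)] Γ(N, W))
    (hψ : ∀ (W W' : X.Opens) (hW : W ≤ U) (hW' : W' ≤ U) (i : W' ⟶ W)
      (z : principalPartsObj k M n W),
      ψ W' hW' (principalPartsRes k M n i z) = N.presheaf.map i.op (ψ W hW z)) :
    ∃ φ : homOn (principalParts k M n) N U,
      ∀ (W : X.Opens) (hW : W ≤ U) (z : principalPartsObj k M n W),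
        φ.1 ⟨W, hW⟩ (toPrincipalParts k M n W z) = ψ W hW z := by
  obtain ⟨φ, h1, h2⟩ := exists_addHom_of_forall (fun W hW => (ψ W hW).toAddMonoidHom) hψ
  refine ⟨⟨fun W => { φ W.1 W.2 with map_smul' := fun t s => ?_ },
    fun W W' i s => h1 W.1 W'.1 W.2 W'.2 i s⟩, h2⟩
  obtain ⟨W, hW⟩ := W
  -- The lift is so far only additive. Linearity may be checked locally, where sections come from
  -- the presheaf and `ψ` is linear.
  refine eq_of_forall_exists_map_eq fun x hx => ?_
  obtain ⟨V, i, hxV, z, hz⟩ := exists_toPrincipalParts_eq k M n s x hx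
  refine ⟨V, i, hxV, ?_⟩
  have hV := i.le.trans hW
  change N.presheaf.map i.op (φ W hW (t • s)) = N.presheaf.map i.op (t • φ W hW s)
  rw [N.map_smul, ← h1 W V hW hV i, ← h1 W V hW hV i, map_smul, ← hz, ← _root_.map_smul, h2, h2]
  exact (ψ V hV).map_smul _ _

end AlgebraicGeometry.Scheme.Modules

lemma PrincipalParts.map_monomialDelta {k R R' ι : Type*} [CommRing k] [CommRing R] [Algebra k R]
    [CommRing R'] [Algebra k R'] (n : ℕ) (σ : R →ₐ[k] R') (x : ι → R) (β : ι →₀ ℕ) :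
    map n σ (monomialDelta k n x β) = monomialDelta k n (fun i => σ (x i)) β := by
  rw [monomialDelta, monomialDelta, map_mk]
  congr 1
  simp [evalDelta, MvPolynomial.aeval_monomial, Finsupp.prod]

/-! ### The stalk of the sheaf of principal parts and its dual operators. -/

namespace AlgebraicGeometry.Scheme.Modules

section

variable {k : Type u} [Field k] {X : Scheme.{u}} [X.Over (Spec (.of k))] {M : X.Modules} {n : ℕ}
  {ι : Type*}

/-- The differential operator `m' ↦ (1 / α!) d ^ α (c m') • m`. -/
lemma exists_sheafHomStalk_eq_dual {U : X.Opens}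
    {d : ∀ W ≤ U, ι → Derivation k Γ(X, W) Γ(X, W)}
    (hd : ∀ (V W : X.Opens) (hV : V ≤ U) (hW : W ≤ U) (i : V ⟶ W) (j : ι) (a : Γ(X, W)),
      resAlgHom k i (d W hW j a) = d V hV j (resAlgHom k i a))
    {c : ∀ W ≤ U, Γ(M, W) →ₗ[Γ(X, W)] Γ(X, W)}
    (hc : ∀ (V W : X.Opens) (hV : V ≤ U) (hW : W ≤ U) (i : V ⟶ W) (m : Γ(M, W)),
      X.presheaf.map i.op (c W hW m) = c V hV (M.presheaf.map i.op m))
    {α : ι →₀ ℕ} (hα : α.degree ≤ n) {x : X} (hx : x ∈ U) (m : M.presheaf.stalk x) :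
    ∃ D : (diffOps k M n).stalk x, ∀ (W : X.Opens) (hW : W ≤ U) (hxW : x ∈ W)
      (z : principalPartsObj k M n W), sheafHomStalk (principalParts k M n) M x D
        ((principalParts k M n).presheaf.germ W x hxW (toPrincipalParts k M n W z)) =
      X.presheaf.germ W x hxW (PrincipalPartsModule.dual (d W hW) hα (c W hW) z) • m := by
  obtain ⟨U', hU', hxU', m, rfl⟩ := M.presheaf.exists_le_germ_eq m hx
  have hnat (W W' : X.Opens) (hW : W ≤ U) (hW' : W' ≤ U) (i : W' ⟶ W)
      (z : principalPartsObj k M n W) :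
      PrincipalPartsModule.dual (d W' hW') hα (c W' hW') (principalPartsRes k M n i z) =
        X.presheaf.map i.op (PrincipalPartsModule.dual (d W hW) hα (c W hW) z) :=
    PrincipalPartsModule.dual_map hα (resAlgHom k i) (M.res k i) (hd W' W hW' hW i)
      (hc W' W hW' hW i) z
  obtain ⟨φ, hφ⟩ := exists_homOn_of_forall (k := k) (M := M) (n := n) (N := M) (U := U')
    (fun W hW => (PrincipalPartsModule.dual (d W (hW.trans hU')) hα
      (c W (hW.trans hU'))).smulRight (M.presheaf.map (homOfLE hW).op m)) (by
      intro W W' hW hW' i z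
      rw [LinearMap.smulRight_apply, LinearMap.smulRight_apply, M.map_smul,
        hnat W W' (hW.trans hU') (hW'.trans hU') i]
      congr 1
      exact (presheaf_map_map M _ _ _ m).symm)
  refine ⟨(diffOps k M n).germ U' x hxU' φ, fun W hW hxW z => ?_⟩
  have hxi : x ∈ W ⊓ U' := ⟨hxW, hxU'⟩
  have h1 : (principalParts k M n).presheaf.germ W x hxW (toPrincipalParts k M n W z) =
      (principalParts k M n).presheaf.germ (W ⊓ U') x hxi (toPrincipalParts k M n (W ⊓ U')
        (principalPartsRes k M n (homOfLE inf_le_left) z)) := by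
    rw [toPrincipalParts_res]
    exact (TopCat.Presheaf.germ_res_apply _ _ _ _ _).symm
  rw [sheafHomStalk_germ, h1, homStalk_germ x hxU' φ inf_le_right, hφ, LinearMap.smulRight_apply,
    germ_smul, hnat W (W ⊓ U') hW]
  congr 1
  · exact TopCat.Presheaf.germ_res_apply _ _ _ _ _
  · exact TopCat.Presheaf.germ_res_apply _ _ _ _ _

end

/-- The stalks of the sheaf of principal parts of a locally free module at a regular point have a
basis whose dual basis comes from differential operators. -/
lemma IsLocallyFreeOfFiniteRank.exists_principalParts_stalk_basis (k : Type u) [Field k]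
    [CharZero k] {X : Scheme.{u}} [X.Over (Spec (.of k))] [LocallyOfFiniteType (X ↘ Spec (.of k))]
    {M : X.Modules} (hM : M.IsLocallyFreeOfFiniteRank) (n : ℕ) {x : X}
    (hx : IsRegularLocalRing (X.presheaf.stalk x)) :
    ∃ (J : Type) (_ : Finite J) (g : J → (principalParts k M n).presheaf.stalk x),
      Submodule.span (X.presheaf.stalk x) (Set.range g) = ⊤ ∧
      (∀ (j : J) (m : M.presheaf.stalk x), ∃ D : (diffOps k M n).stalk x,
        sheafHomStalk (principalParts k M n) M x D (g j) = m ∧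
        ∀ i, i ≠ j → sheafHomStalk (principalParts k M n) M x D (g i) = 0) ∧
      (Nonempty J → FaithfulSMul (X.presheaf.stalk x) (M.presheaf.stalk x)) := by
  classical
  obtain ⟨U₀, hxU₀, r, e, c, hc, hce, hm⟩ := hM.exists_dual x
  obtain ⟨U, hU, hxU, hUU₀, ι, _, t, d, htd⟩ := exists_isAffineOpen_isCoordinates k hx hxU₀
  obtain ⟨d', hd', hd'x⟩ := exists_derivation k hU htd
  obtain ⟨W₀, hW₀U, -, hxW₀, hW₀⟩ := hd'x x hxU U hxU
  have hfin : Finite {β : ι →₀ ℕ // β.degree ≤ n} := (Finsupp.finite_of_degree_le n).to_subtype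
  have hcW (W : X.Opens) (hW : W ≤ U₀) (p q : Fin r) :
      c W hW p (M.presheaf.map (homOfLE hW).op (e q)) = if p = q then 1 else 0 := by
    rw [← hc W U₀ hW le_rfl, hce]
    split_ifs
    · exact map_one (X.presheaf.map (homOfLE hW).op).hom
    · exact map_zero (X.presheaf.map (homOfLE hW).op).hom
  let z (W : X.Opens) (hW : W ≤ U) (i : {β : ι →₀ ℕ // β.degree ≤ n} × Fin r) :
      principalPartsObj k M n W :=
    PrincipalPartsModule.tmul k n
      (PrincipalParts.monomialDelta k n (fun j => resAlgHom k (homOfLE hW) (t j)) i.1.1)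
      (M.presheaf.map (homOfLE (hW.trans hUU₀)).op (e i.2))
  have hz (W V : X.Opens) (hW : W ≤ U) (hV : V ≤ U) (i : V ⟶ W) (l) :
      principalPartsRes k M n i (z W hW l) = z V hV l := by
    refine (PrincipalPartsModule.map_tmul n (resAlgHom k i) (M.res k i) _ _).trans ?_
    rw [PrincipalParts.map_monomialDelta]
    refine congrArg₂ (PrincipalPartsModule.tmul k n) ?_ (presheaf_map_map M _ _ _ _)
    congr 1
    funext j
    exact AlgebraicGeometry.Scheme.presheaf_map_map _ _ _ _
  refine ⟨{β : ι →₀ ℕ // β.degree ≤ n} × Fin r, inferInstance,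
    fun i => (principalParts k M n).presheaf.germ W₀ x hxW₀
      (toPrincipalParts k M n W₀ (z W₀ hW₀U i)), ?_, fun j m => ?_, fun ⟨j⟩ => ⟨fun {a b} hab => ?_⟩⟩
  · rw [eq_top_iff]
    rintro s -
    obtain ⟨V, hV, hxV, s, rfl⟩ := exists_germ_toPrincipalParts_eq k M n hxW₀ s
    -- The section lives over some `V`, where the restricted functions need not be known to be
    -- coordinates; shrinking to `W` restores this.
    obtain ⟨W, hWU, hWV, hxW, hW⟩ := hd'x x hxU V hxV
    have hg (s : principalPartsObj k M n V) :
        (principalParts k M n).presheaf.germ V x hxV (toPrincipalParts k M n V s) =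
        (principalParts k M n).presheaf.germ W x hxW (toPrincipalParts k M n W
          (principalPartsRes k M n (homOfLE hWV) s)) := by
      rw [toPrincipalParts_res]
      exact (TopCat.Presheaf.germ_res_apply _ _ _ _ _).symm
    have he : Submodule.span Γ(X, W) (Set.range fun p =>
        M.presheaf.map (homOfLE (hWU.trans hUU₀)).op (e p)) = ⊤ := by
      rw [eq_top_iff]
      rintro m -
      rw [hm W (hWU.trans hUU₀) m]
      exact sum_mem fun p _ => Submodule.smul_mem _ _ (Submodule.subset_span ⟨p, rfl⟩)
    rw [hg]
    generalize principalPartsRes k M n (homOfLE hWV) s = s'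
    induction PrincipalPartsModule.mem_span_monomialDelta_tmul hW he s'
      using Submodule.span_induction with
    | zero => rw [map_zero, map_zero]; exact zero_mem _
    | add a b _ _ ha hb => rw [map_add, map_add]; exact add_mem ha hb
    | smul a b _ hb => rw [_root_.map_smul, germ_smul]; exact Submodule.smul_mem _ _ hb
    | mem _ h =>
      obtain ⟨i, rfl⟩ := h
      refine Submodule.subset_span ⟨i, ?_⟩
      refine (TopCat.Presheaf.germ_res_apply (principalParts k M n).presheaf
        (homOfLE (hWV.trans hV)) x hxW (toPrincipalParts k M n W₀ (z W₀ hW₀U i))).symm.trans ?_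
      rw [← toPrincipalParts_res, hz W₀ W hW₀U hWU]
  · obtain ⟨D, hD⟩ := exists_sheafHomStalk_eq_dual (n := n) hd'
      (c := fun W hW => c W (hW.trans hUU₀) j.2) (fun V W _ _ i m => hc V W _ _ i _ m)
      j.1.2 hxU m
    have hD' (i) : sheafHomStalk (principalParts k M n) M x D
        ((principalParts k M n).presheaf.germ W₀ x hxW₀
          (toPrincipalParts k M n W₀ (z W₀ hW₀U i))) = if i = j then m else 0 := by
      rw [hD W₀ hW₀U]
      by_cases hp : j.2 = i.2
      · rw [PrincipalPartsModule.dual_monomialDelta_tmul _ _ hW₀ _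
          ((hcW W₀ _ j.2 i.2).trans (if_pos hp)), Finsupp.single_apply]
        by_cases hβ : i.1.1 = j.1.1
        · rw [if_pos hβ, if_pos (Prod.ext (Subtype.ext hβ) hp.symm), map_one, one_smul]
        · rw [if_neg hβ, if_neg fun h => hβ (by rw [h]), map_zero, zero_smul]
      · rw [PrincipalPartsModule.dual_tmul_of_eq_zero _ _ _
          ((hcW W₀ _ j.2 i.2).trans (if_neg hp)), if_neg fun h => hp (by rw [h]), map_zero,
          zero_smul]
    exact ⟨D, (hD' j).trans (if_pos rfl), fun i hi => (hD' i).trans (if_neg hi)⟩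
  -- An index `j` provides a basis section of `M`, and its coordinate functional recovers any scalar
  -- multiplied onto it.
  · obtain ⟨A, hA, hxA, a, rfl⟩ := X.presheaf.exists_le_germ_eq a hxU₀
    obtain ⟨B, hB, hxB, b, rfl⟩ := X.presheaf.exists_le_germ_eq b hxA
    have h := hab (M.presheaf.germ U₀ x hxU₀ (e j.2))
    have hBU₀ := hB.trans hA
    rw [← TopCat.Presheaf.germ_res_apply X.presheaf (homOfLE hB) x hxB a] at h ⊢
    rw [← TopCat.Presheaf.germ_res_apply M.presheaf (homOfLE hBU₀) x hxB (e j.2), ← germ_smul,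
      ← germ_smul] at h
    obtain ⟨C, hxC, i, i', h⟩ := TopCat.Presheaf.germ_eq M.presheaf x hxB hxB _ _ h
    obtain rfl := Subsingleton.elim i i'
    have h := congrArg (c C (i.le.trans hBU₀) j.2) h
    have hcB (s : Γ(X, B)) :
        c B hBU₀ j.2 (s • M.presheaf.map (homOfLE hBU₀).op (e j.2)) = s := by
      rw [LinearMap.map_smul, hcW B hBU₀, if_pos rfl, smul_eq_mul, mul_one]
    rw [← hc C B _ hBU₀, ← hc C B _ hBU₀, hcB, hcB] at h
    rw [← TopCat.Presheaf.germ_res_apply X.presheaf i x hxC, h]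
    exact TopCat.Presheaf.germ_res_apply _ _ _ _ _

end AlgebraicGeometry.Scheme.Modules

/-! ### Extension of linear maps and injectivity on the closed fibre. -/

namespace IsLocalRing

variable {k A V P M : Type*} [Field k] [CommRing A] [IsLocalRing A] [Algebra k A]
  [AddCommGroup V] [Module k V] [FiniteDimensional k V]
  [AddCommGroup P] [Module k P] [Module A P] [IsScalarTower k A P]
  [AddCommGroup M] [Module k M] [Module A M] [IsScalarTower k A M] (τ : V →ₗ[k] P)

/-- A linear map from a vector space to a finite free module that is injective on the fibre at the
closed point allows to extend all linear maps. -/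
lemma exists_extension_of_injective_fibre [Module.Finite A P] [Module.Free A P]
    (h : Function.Injective (LinearMap.liftBaseChange (ResidueField A)
      (((TensorProduct.mk A (ResidueField A) P 1).restrictScalars k).comp τ)))
    (f : V →ₗ[k] M) : ∃ T : P →ₗ[A] M, ∀ v, T (τ v) = f v := by
  let L : A ⊗[k] V →ₗ[A] P := LinearMap.liftBaseChange A τ
  have hL : Function.Injective (L.lTensor (ResidueField A)) := by
    have h1 : (L.lTensor (ResidueField A)).comp
        (TensorProduct.AlgebraTensorModule.cancelBaseChange k A A
          (ResidueField A) V).symm.toLinearMap =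
        (LinearMap.liftBaseChange (ResidueField A)
          (((TensorProduct.mk A (ResidueField A) P 1).restrictScalars k).comp τ)).restrictScalars
            A := by
      ext v
      simp [L, smul_tmul']
    have h2 : Function.Injective ((L.lTensor (ResidueField A)).comp
        (TensorProduct.AlgebraTensorModule.cancelBaseChange k A A
          (ResidueField A) V).symm.toLinearMap) := by
      rw [h1]
      exact h
    rw [LinearMap.coe_comp] at h2
    exact (Function.Injective.of_comp_iff' _ (LinearEquiv.bijective _)).mp h2
  -- Over a local ring, a map into a finite free module that is injective on the closed fibre has a
  -- retraction; composing with it extends `f`.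
  obtain ⟨L', hL'⟩ := (split_injective_iff_lTensor_residueField_injective L).mpr hL
  refine ⟨(LinearMap.liftBaseChange A f).comp L', fun v => ?_⟩
  have h1 : L' (τ v) = 1 ⊗ₜ v := by
    have : L (1 ⊗ₜ v) = τ v := by simp [L]
    rw [← this]
    exact LinearMap.congr_fun hL' _
  simp [h1]

/-- By Nakayama some `e` is nonzero in the fibre of `M`. Extending `b.coord j` times `e` and
reducing modulo the maximal ideal shows that the `j`-th coordinate of a kernel element, times the
class of `e`, is zero. -/
lemma injective_fibre_of_exists_extension [Module.Finite A M] [Nontrivial M]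
    (h : ∀ f : V →ₗ[k] M, ∃ T : P →ₗ[A] M, ∀ v, T (τ v) = f v) :
    Function.Injective (LinearMap.liftBaseChange (ResidueField A)
      (((TensorProduct.mk A (ResidueField A) P 1).restrictScalars k).comp τ)) := by
  obtain ⟨e, he⟩ : ∃ e : M, e ∉ maximalIdeal A • (⊤ : Submodule A M) := by
    by_contra! H
    exact top_ne_bot (Submodule.eq_bot_of_le_smul_of_le_jacobson_bot _ _ Module.Finite.fg_top
      (fun m _ => H m) (maximalIdeal_le_jacobson _))
  let b := Module.finBasis k V
  let bκ := b.baseChange (ResidueField A)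
  rw [injective_iff_map_eq_zero]
  intro z hz
  refine bκ.ext_elem fun j => ?_
  rw [map_zero, Finsupp.zero_apply]
  obtain ⟨T, hT⟩ := h ((b.coord j).smulRight e)
  have h1 : (T.baseChange (ResidueField A)).comp (LinearMap.liftBaseChange (ResidueField A)
      (((TensorProduct.mk A (ResidueField A) P 1).restrictScalars k).comp τ)) =
      (bκ.coord j).smulRight (1 ⊗ₜ[A] e) := by
    ext v
    simp [bκ, hT, ← algebraMap_smul A, TensorProduct.tmul_smul]
  have h2 := LinearMap.congr_fun h1 z
  rw [LinearMap.comp_apply, hz, map_zero, LinearMap.smulRight_apply] at h2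
  refine (smul_eq_zero.mp h2.symm).resolve_right fun h3 => he ?_
  have h4 := (TensorProduct.one_tmul_eq_zero_iff (B := A) residue_surjective).mp h3
  rwa [IsLocalRing.ResidueField.algebraMap_eq, ker_residue] at h4

end IsLocalRing

/-! ### Injectivity of the Taylor map against surjectivity of evaluation. -/

namespace AlgebraicGeometry.Scheme.Modules

lemma IsLocallyFreeOfFiniteRank.finite_stalk {X : Scheme.{u}} {M : X.Modules}
    (hM : M.IsLocallyFreeOfFiniteRank) (x : X) :
    Module.Finite (X.presheaf.stalk x) (M.presheaf.stalk x) := by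
  obtain ⟨U, hxU, r, e, c, -, -, hm⟩ := hM.exists_dual x
  refine ⟨Submodule.fg_def.mpr ⟨_, Set.finite_range fun p => M.presheaf.germ U x hxU (e p), ?_⟩⟩
  rw [eq_top_iff]
  rintro m -
  obtain ⟨W, hW, hxW, m, rfl⟩ := M.presheaf.exists_le_germ_eq m hxU
  rw [hm W hW m, map_sum]
  refine sum_mem fun p _ => ?_
  rw [germ_smul]
  refine Submodule.smul_mem _ _ (Submodule.subset_span ⟨p, ?_⟩)
  exact (TopCat.Presheaf.germ_res_apply _ _ _ _ _).symm

section

variable (k : Type u) [Field k] [CharZero k] {X : Scheme.{u}} [X.Over (Spec (.of k))]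
  [LocallyOfFiniteType (X ↘ Spec (.of k))] {M : X.Modules} (n : ℕ) {x : X}

/-- A linear map is determined by its values on the generators `g j`, and the dual operators realize
these values one at a time. -/
lemma IsLocallyFreeOfFiniteRank.sheafHomStalk_principalParts_surjective
    (hM : M.IsLocallyFreeOfFiniteRank) (hx : IsRegularLocalRing (X.presheaf.stalk x)) :
    Function.Surjective (sheafHomStalk (principalParts k M n) M x) := by
  classical
  obtain ⟨J, _, g, hg, hD, -⟩ := hM.exists_principalParts_stalk_basis k n hx
  have := Fintype.ofFinite J
  intro T
  choose D hD1 hD2 using fun j => hD j (T (g j))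
  refine ⟨∑ j, D j, LinearMap.ext_on_range hg fun i => ?_⟩
  rw [map_sum, LinearMap.sum_apply, Finset.sum_eq_single i (fun j _ hj => hD2 j i hj.symm) (by simp),
    hD1]

/-- Applying the dual operators to a relation among the generators shows that each coefficient
annihilates `M_x`; faithfulness makes it zero. -/
lemma IsLocallyFreeOfFiniteRank.finite_free_principalParts_stalk
    (hM : M.IsLocallyFreeOfFiniteRank) (hx : IsRegularLocalRing (X.presheaf.stalk x)) :
    Module.Finite (X.presheaf.stalk x) ((principalParts k M n).presheaf.stalk x) ∧
      Module.Free (X.presheaf.stalk x) ((principalParts k M n).presheaf.stalk x) := by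
  classical
  obtain ⟨J, _, g, hg, hD, hf⟩ := hM.exists_principalParts_stalk_basis k n hx
  have := Fintype.ofFinite J
  have hli : LinearIndependent (X.presheaf.stalk x) g := by
    rw [Fintype.linearIndependent_iff]
    intro a ha j
    have := hf ⟨j⟩
    refine FaithfulSMul.eq_of_smul_eq_smul (α := M.presheaf.stalk x) fun m => ?_
    obtain ⟨D, hD1, hD2⟩ := hD j m
    have h := congrArg (sheafHomStalk (principalParts k M n) M x D) ha
    rw [map_sum, map_zero, Finset.sum_eq_single j (fun i _ hi => by
      rw [_root_.map_smul, hD2 i hi, smul_zero]) (by simp), _root_.map_smul, hD1] at h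
    rw [h, zero_smul]
  let b := Module.Basis.mk hli hg.ge
  exact ⟨.of_basis b, .of_basis b⟩

variable {V : Type*} [AddCommGroup V] [Module k V] [FiniteDimensional k V]
  (ι : V →ₗ[k] M.presheaf.stalk x)

/-- Surjectivity of evaluation is the extension property along the Taylor map, since every linear
map on the stalk comes from an operator. Separatedness enters only when `M_x = 0`: evaluation is
then trivially surjective, and injectivity of the zero map in one order gives it in every order. -/
lemma IsLocallyFreeOfFiniteRank.evalMap_surjective_iff
    (hM : M.IsLocallyFreeOfFiniteRank) (hx : IsRegularLocalRing (X.presheaf.stalk x))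
    (hV : IsSeparatedAt k M x ι) :
    Function.Surjective (evalMap k M n x ι) ↔ Function.Injective (taylorFibre k M n x ι) := by
  obtain ⟨_, _⟩ := hM.finite_free_principalParts_stalk k n hx
  have := hM.finite_stalk x
  refine ⟨fun h => ?_, fun h f => ?_⟩
  · rcases subsingleton_or_nontrivial (M.presheaf.stalk x) with hM0 | hM0
    · obtain ⟨N, hN⟩ := hV
      have h0 (n : ℕ) : taylorFibre k M n x ι = 0 := by
        ext v
        simp [taylorFibre_tmul, Subsingleton.elim (ι v) 0]
      have h1 := hN N le_rfl
      rw [h0] at h1 ⊢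
      exact fun a b _ => h1 rfl
    · refine IsLocalRing.injective_fibre_of_exists_extension (M := M.presheaf.stalk x) _ fun f => ?_
      obtain ⟨D, rfl⟩ := h f
      exact ⟨sheafHomStalk _ M x D, fun v => rfl⟩
  · obtain ⟨T, hT⟩ := IsLocalRing.exists_extension_of_injective_fibre _ h f
    obtain ⟨D, rfl⟩ := hM.sheafHomStalk_principalParts_surjective k n hx T
    exact ⟨D, LinearMap.ext hT⟩

lemma IsLocallyFreeOfFiniteRank.isLeast_injOrder
    (hM : M.IsLocallyFreeOfFiniteRank) (hx : IsRegularLocalRing (X.presheaf.stalk x))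
    (hV : IsSeparatedAt k M x ι) :
    IsLeast {n : ℕ | Function.Injective (M.taylorFibre k n x ι)} (M.injOrder k x ι) ∧
      IsLeast {n : ℕ | Function.Surjective (M.evalMap k n x ι)} (M.injOrder k x ι) := by
  simp only [evalMap_surjective_iff k _ ι hM hx hV, and_self]
  obtain ⟨N, hN⟩ := hV
  exact ⟨Nat.sInf_mem ⟨N, hN N le_rfl⟩, fun n hn => Nat.sInf_le hn⟩

end

end AlgebraicGeometry.Scheme.Modules

end

theorem mainTheorem2 (k : Type u) [Field k] [CharZero k]
    (X : Scheme.{u}) [X.Over (Spec (.of k))] [IrreducibleSpace X]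
    [LocallyOfFiniteType (X ↘ Spec (.of k))] [QuasiCompact (X ↘ Spec (.of k))]
    (hX : ∀ x : X, IsRegularLocalRing (X.presheaf.stalk x))
    (M : X.Modules) (hM : M.IsLocallyFreeOfFiniteRank) (x : X) :
    (∀ (V : Submodule k (M.presheaf.stalk x)) [FiniteDimensional k V],
      M.IsSeparatedAt k x V.subtype →
        IsLeast {n : ℕ | Function.Injective (M.taylorFibre k n x V.subtype)}
            (M.injOrder k x V.subtype) ∧
          IsLeast {n : ℕ | Function.Surjective (M.evalMap k n x V.subtype)}
            (M.injOrder k x V.subtype)) ∧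
    (∀ (V : Submodule k Γ(M, ⊤)) [FiniteDimensional k V],
      M.IsSeparatedAt k x (M.globalGerm k x V) →
        IsLeast {n : ℕ | Function.Injective (M.taylorFibre k n x (M.globalGerm k x V))}
            (M.injOrder k x (M.globalGerm k x V)) ∧
          IsLeast {n : ℕ | Function.Surjective (M.evalMap k n x (M.globalGerm k x V))}
            (M.injOrder k x (M.globalGerm k x V))) := by
  exact ⟨fun V _ hV => hM.isLeast_injOrder k V.subtype (hX x) hV,
    fun V _ hV => hM.isLeast_injOrder k (M.globalGerm k x V) (hX x) hV⟩
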